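/- Let $n\ge 0$ be an integer and let $F(x,y_0,y_1,\ldots,y_n)\not\equiv 0$ be a function holomorphic near $0\in\mathbb C^{n+2}$. Let $$\varphi=\sum_{k=1}^{\infty}c_kx^{\lambda_k},\qquad c_k\in\mathbb C,\quad \lambda_k\in\mathbb R,\quad 0<\lambda_1\le\lambda_2\le\ldots\to+\infty,$$ be a generalized power series with real exponents. Suppose that $\varphi$ is a formal solution of an equation $F(x,y,\Delta y,\ldots,\Delta^n y)=0$, where $\Delta$ is one of the following operators, acting on generalized power series term by term: 1. $\Delta=\delta=x\,\frac{d}{dx}$ (differential equation): $\delta x^{\lambda}=\lambda x^{\lambda}$; 2. $\Delta=\sigma: y(x)\mapsto y(qx)$ with $q\in\mathbb C\setminus\{0,1\}$ ($q$-difference equation): $\sigma x^{\lambda}=q^{\lambda}x^{\lambda}$, where $q^\lambda=e^{\lambda\ln q}$ for an arbitrary fixed choice of the value $\ln q$; 3. $\Delta=\mu: y(x)\mapsto y(x^{\ell})$ with $\ell\in\mathbb N$, $\ell\ge 2$ (Mahler equation): $\mu x^{\lambda}=x^{\ell\lambda}$. Here "formal solution" means that, after substituting $x,\varphi,\Delta\varphi,\ldots,\Delta^n\varphi$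 into the Taylor series of $F$ at $0$ and collecting equal powers of $x$ (only finitely many terms contribute to each power), all coefficients are zero. No further condition (such as non-vanishing of a partial derivative of $F$ along $\varphi$) is imposed. Then there exist finitely many positive real numbers $\rho_1,\ldots,\rho_\tau$, linearly independent over $\mathbb Z$, such that every exponent of $\varphi$ occurring with a nonzero coefficient belongs to the additive semigroup $\Gamma$ generated by $\rho_1,\ldots,\rho_\tau$; that is, $\varphi\in\mathbb C[[x^{\Gamma}]]$. -/

import Mathlib

open Filter Topology

noncomputable section

namespace GenSeries

/-- `φ` is a generalized power series with real exponents: `φ = ∑_{k ≥ 0} c k * x ^ (lam k)` with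
`0 < lam 0 ≤ lam 1 ≤ ... → +∞`. Formal series in real powers of `x` are represented by Hahn
series; terms with equal exponents are collected (for each `a` only finitely many `k` satisfy
`lam k = a`), and the `c k` may vanish. -/
def IsGeneralizedPowerSeries (φ : HahnSeries ℝ ℂ) : Prop :=
  ∃ (c : ℕ → ℂ) (lam : ℕ → ℝ),
    0 < lam 0 ∧ Monotone lam ∧ Tendsto lam atTop atTop ∧
      ∀ a : ℝ, φ.coeff a = ∑ᶠ (k : ℕ) (_ : lam k = a), c k

/-- The operator `δ = x d/dx`: `∑ c_a x^a ↦ ∑ a c_a x^a`. -/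
def eulerOp (φ : HahnSeries ℝ ℂ) : HahnSeries ℝ ℂ where
  coeff a := (a : ℂ) * φ.coeff a
  isPWO_support' := φ.isPWO_support.mono fun _ ha => right_ne_zero_of_mul ha

/-- The operator `σ : y(x) ↦ y(qx)`, where `q = exp L` and `L` is the chosen value of `ln q`:
`∑ c_a x^a ↦ ∑ q^a c_a x^a` with `q^a = exp (a L)`. -/
def qOp (L : ℂ) (φ : HahnSeries ℝ ℂ) : HahnSeries ℝ ℂ where
  coeff a := Complex.exp ((a : ℂ) * L) * φ.coeff a
  isPWO_support' := φ.isPWO_support.mono fun _ ha => right_ne_zero_of_mul ha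

/-- The Mahler operator `μ : y(x) ↦ y(x^ℓ)`: `∑ c_a x^a ↦ ∑ c_a x^(ℓ a)`. -/
def mahlerOp (l : ℕ) (hl : 2 ≤ l) (φ : HahnSeries ℝ ℂ) : HahnSeries ℝ ℂ where
  coeff a := φ.coeff (a / l)
  isPWO_support' := by
    have hl0 : (0 : ℝ) < l := by exact_mod_cast (by omega : 0 < l)
    refine (φ.isPWO_support.image_of_monotone (f := fun b : ℝ => (l : ℝ) * b)
      (fun a b hab => mul_le_mul_of_nonneg_left hab hl0.le)).mono fun a ha => ?_
    exact ⟨a / l, ha, by field_simp⟩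

/-- The Taylor series at the origin of a function of `m` complex variables: the coefficient at the
multi-index `p` is `∂^p F(0) / p!`. The mixed derivative `∂^p F(0)` is the value of the derivative
of order `|p|` on the list of basis vectors in which the `i`-th one occurs `p i` times. -/
def taylorSeries {m : ℕ} (F : (Fin m → ℂ) → ℂ) : MvPowerSeries (Fin m) ℂ := fun p =>
  (∏ i, ((p i).factorial : ℂ))⁻¹ *
    iteratedFDeriv ℂ p.toMultiset.toList.length F 0
      (fun k => Pi.single (p.toMultiset.toList.get k) 1)

/-- The coefficient at `x^a` of the formal substitution
`P(Φ₁, ..., Φₘ) = ∑_p P_p Φ₁^{p₁} ⋯ Φₘ^{pₘ}`. When all exponents of the `Φ i` are positive, only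
finitely many `p` contribute to a given `a` (`finite_substCoeff`). -/
def substCoeff {m : ℕ} (P : MvPowerSeries (Fin m) ℂ) (Φ : Fin m → HahnSeries ℝ ℂ) (a : ℝ) : ℂ :=
  ∑ᶠ p : Fin m →₀ ℕ, MvPowerSeries.coeff p P * (∏ i, Φ i ^ p i).coeff a

/-- The tuple `(x, φ, D φ, ..., D^n φ)`. -/
def jet (n : ℕ) (D : HahnSeries ℝ ℂ → HahnSeries ℝ ℂ) (φ : HahnSeries ℝ ℂ) :
    Fin (n + 2) → HahnSeries ℝ ℂ :=
  Fin.cons (HahnSeries.single (1 : ℝ) (1 : ℂ)) fun j : Fin (n + 1) => D^[(j : ℕ)] φ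

/-- `φ` is a formal solution of `F(x, y, D y, ..., D^n y) = 0`: after the substitution of `φ` all
coefficients vanish. -/
def IsFormalSolution (n : ℕ) (F : (Fin (n + 2) → ℂ) → ℂ)
    (D : HahnSeries ℝ ℂ → HahnSeries ℝ ℂ) (φ : HahnSeries ℝ ℂ) : Prop :=
  ∀ a : ℝ, substCoeff (taylorSeries F) (jet n D φ) a = 0

/-- `ℂ[[x^Γ]]`: the generalized power series whose exponents (with nonzero coefficient) lie
in `Γ`. -/
def seriesWithExponents (Γ : AddSubsemigroup ℝ) : Set (HahnSeries ℝ ℂ) :=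
  {φ | IsGeneralizedPowerSeries φ ∧ φ.support ⊆ (Γ : Set ℝ)}

theorem exists_le_support {φ : HahnSeries ℝ ℂ} (h : φ.support ⊆ Set.Ioi 0) :
    ∃ ε : ℝ, 0 < ε ∧ φ.support ⊆ Set.Ici ε := by
  by_cases hne : φ.support.Nonempty
  · exact ⟨φ.isWF_support.min hne, h (φ.isWF_support.min_mem hne),
      fun a ha => φ.isWF_support.min_le hne ha⟩
  · exact ⟨1, one_pos, fun a ha => (hne ⟨a, ha⟩).elim⟩

theorem support_mul_le {φ ψ : HahnSeries ℝ ℂ} {s t : ℝ} (h : φ.support ⊆ Set.Ici s)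
    (h' : ψ.support ⊆ Set.Ici t) : (φ * ψ).support ⊆ Set.Ici (s + t) := by
  intro a ha
  obtain ⟨b, hb, c, hc, rfl⟩ := HahnSeries.support_mul_subset ha
  have h1 : s ≤ b := h hb
  have h2 : t ≤ c := h' hc
  exact add_le_add h1 h2

theorem support_pow_le {φ : HahnSeries ℝ ℂ} {s : ℝ} (h : φ.support ⊆ Set.Ici s) (k : ℕ) :
    (φ ^ k).support ⊆ Set.Ici (k * s) := by
  induction k with
  | zero =>
    intro a ha
    rw [pow_zero] at ha
    have : a = 0 := HahnSeries.support_single_subset ha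
    simp [this]
  | succ k ih =>
    rw [pow_succ]
    convert support_mul_le ih h using 2
    push_cast; ring

theorem support_prod_le {ι : Type*} (s : Finset ι) (Φ : ι → HahnSeries ℝ ℂ) (t : ι → ℝ)
    (h : ∀ i ∈ s, (Φ i).support ⊆ Set.Ici (t i)) :
    (∏ i ∈ s, Φ i).support ⊆ Set.Ici (∑ i ∈ s, t i) := by
  classical
  induction s using Finset.induction_on with
  | empty =>
    intro a ha
    rw [Finset.prod_empty] at ha
    have : a = 0 := HahnSeries.support_single_subset ha
    simp [this]
  | insert i s his ih =>
    rw [Finset.prod_insert his, Finset.sum_insert his]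
    exact support_mul_le (h i (Finset.mem_insert_self i s))
      (ih fun j hj => h j (Finset.mem_insert_of_mem hj))

/-- The substitution is well defined: each coefficient is a finite sum. -/
theorem finite_substCoeff {m : ℕ} (Φ : Fin m → HahnSeries ℝ ℂ)
    (hΦ : ∀ i, (Φ i).support ⊆ Set.Ioi 0) (a : ℝ) :
    {p : Fin m →₀ ℕ | (∏ i, Φ i ^ p i).coeff a ≠ 0}.Finite := by
  choose ε hε hsupp using fun i => exists_le_support (hΦ i)
  refine (Set.finite_Iic (Finsupp.equivFunOnFinite.symm fun i => ⌊a / ε i⌋₊)).subset ?_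
  intro p hp i
  have h1 : ∑ i, (p i : ℝ) * ε i ≤ a :=
    support_prod_le Finset.univ (fun i => Φ i ^ p i) (fun i => p i * ε i)
      (fun i _ => support_pow_le (hsupp i) (p i)) hp
  have h2 : (p i : ℝ) * ε i ≤ ∑ i, (p i : ℝ) * ε i :=
    Finset.single_le_sum (f := fun i => (p i : ℝ) * ε i)
      (fun j _ => mul_nonneg (Nat.cast_nonneg _) (hε j).le) (Finset.mem_univ i)
  exact Nat.le_floor ((le_div_iff₀ (hε i)).2 (h2.trans h1))

theorem IsGeneralizedPowerSeries.support_pos {φ : HahnSeries ℝ ℂ}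
    (h : IsGeneralizedPowerSeries φ) : φ.support ⊆ Set.Ioi 0 := by
  obtain ⟨c, lam, h0, hm, -, hc⟩ := h
  intro a ha
  by_contra hneg
  refine ha ?_
  rw [hc a]
  have hne : ∀ k, lam k ≠ a := fun k hk =>
    hneg (hk ▸ lt_of_lt_of_le h0 (hm (Nat.zero_le k)))
  simp [hne]

theorem jet_support_pos (n : ℕ) (D : HahnSeries ℝ ℂ → HahnSeries ℝ ℂ)
    (hD : ∀ ψ : HahnSeries ℝ ℂ, ψ.support ⊆ Set.Ioi 0 → (D ψ).support ⊆ Set.Ioi 0)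
    {φ : HahnSeries ℝ ℂ} (hφ : φ.support ⊆ Set.Ioi 0) (i : Fin (n + 2)) :
    (jet n D φ i).support ⊆ Set.Ioi 0 := by
  refine Fin.cases ?_ (fun j => ?_) i
  · intro a ha
    have : a = 1 := HahnSeries.support_single_subset ha
    simp [this]
  · change (D^[(j : ℕ)] φ).support ⊆ Set.Ioi 0
    induction (j : ℕ) with
    | zero => exact hφ
    | succ k ih => rw [Function.iterate_succ_apply']; exact hD _ ih

theorem eulerOp_support_pos (ψ : HahnSeries ℝ ℂ) (h : ψ.support ⊆ Set.Ioi 0) :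
    (eulerOp ψ).support ⊆ Set.Ioi 0 :=
  fun _ ha => h (right_ne_zero_of_mul ha)

theorem qOp_support_pos (L : ℂ) (ψ : HahnSeries ℝ ℂ) (h : ψ.support ⊆ Set.Ioi 0) :
    (qOp L ψ).support ⊆ Set.Ioi 0 :=
  fun _ ha => h (right_ne_zero_of_mul ha)

theorem mahlerOp_support_pos (l : ℕ) (hl : 2 ≤ l) (ψ : HahnSeries ℝ ℂ)
    (h : ψ.support ⊆ Set.Ioi 0) : (mahlerOp l hl ψ).support ⊆ Set.Ioi 0 := by
  intro a ha
  have hl0 : (0 : ℝ) < l := by exact_mod_cast (by omega : 0 < l)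
  have : 0 < a / l := h ha
  exact (div_pos_iff_of_pos_right hl0).1 this

end GenSeries

end

noncomputable section

namespace GenSeries

/-! No partial derivative of `F` is assumed nonzero along `φ`, so a regular relation is manufactured
first (`exists_regular_relation`). Slicing and differentiating the Taylor series of `F` yields a
series `G` that does not involve `y_0, …, y_{j-1}`, vanishes along `φ`, and has `∂G/∂y_j` nonzero
along `φ`. The search succeeds because a nonzero series in `x` alone cannot vanish.

Put `l = 1` for `δ` and `σ`. Let `ν` be the least exponent in the values along `φ` of those
`∂G/∂y_i` that matter to leading order: all of them if `l = 1`, only `∂G/∂y_j` in the Mahler case.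
Truncate `φ` below a large exponent `c`. By Taylor's formula the value of `G` at the truncation has
coefficient `-Λ(c) φ_c` at `x^(ν + l^j c)` (`coeff_evalSeries_truncLT`). Here `Λ(c)` is a nonzero
polynomial in the multiplier of `x^c` if `l = 1`, and a nonzero constant in the Mahler case. If
`Λ(c) φ_c ≠ 0`, this exponent is a sum of exponents of the truncated data, so `c + ν/l^j` lies in
the monoid generated by `1/l^j` and the exponents of `φ` below `c`. The `c` with `Λ(c) = 0` lie in
finitely many residue classes.

The recursion controls `c + ν'` with `ν' = ν/l^j`, not `c` itself. `exists_generators_of_recursion`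
absorbs the shift by proving that `c - ν'` lies in a fixed finitely generated monoid. Finally
`exists_independent_generators` encloses finitely many positive reals in a simplicial cone with
positive independent generators. -/

/-! ### Positive independent generators: simplicial cones over the rationals. -/

theorem toNNRat_smul {q : ℚ} (hq : 0 ≤ q) (x : ℝ) : q.toNNRat • x = (q : ℝ) * x := by
  lift q to ℚ≥0 using hq
  simp [NNRat.smul_def]

theorem mem_span_nnrat_of_sum {ι : Type*} [Fintype ι] {ρ : ι → ℝ} (m : ι → ℚ) (hm : ∀ i, 0 ≤ m i) :
    ∑ i, (m i : ℝ) * ρ i ∈ Submodule.span ℚ≥0 (Set.range ρ) := by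
  refine Submodule.sum_mem _ fun i _ => ?_
  rw [← toNNRat_smul (hm i)]
  exact Submodule.smul_mem _ _ (Submodule.subset_span ⟨i, rfl⟩)

/-- Subtracting rational multiples of `ρ k` from the other `ρ i` keeps linear independence. -/
theorem linearIndependent_sub_smul {ι : Type*} [Fintype ι] {ρ : ι → ℝ}
    (h : LinearIndependent ℚ ρ) (k : ι) (c : ι → ℚ) (hc : c k = 0) :
    LinearIndependent ℚ fun i => ρ i - c i * ρ k := by
  classical
  rw [Fintype.linearIndependent_iff] at h ⊢
  intro g hg
  have key := h (fun i => g i - if i = k then ∑ j, g j * c j else 0) (by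
    rw [← hg]
    simp only [Rat.smul_def, Rat.cast_sub, sub_mul, Finset.sum_sub_distrib, mul_sub]
    congr 1
    rw [Finset.sum_eq_single k]
    · simp [Finset.sum_mul, mul_assoc]
    · intro b _ hb; simp [hb]
    · simp)
  have h1 : ∀ i, i ≠ k → g i = 0 := fun i hi => by simpa [hi] using key i
  have h2 : ∑ j, g j * c j = 0 := Finset.sum_eq_zero fun j _ => by
    by_cases hj : j = k
    · simp [hj, hc]
    · simp [h1 j hj]
  intro i
  by_cases hi : i = k
  · simpa [hi, h2] using key k
  · exact h1 i hi

/-- Induction on the number of negative coefficients. To remove a negative `m k`, parts of `ρ k` are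
split off from the `ρ i` with positive coefficient. The sum is unchanged, the coefficient at `k`
becomes `m k + ∑ m i * c i`, and the old cone lies in the new one. -/
theorem exists_independent_cone_of_sum {ι : Type*} [Fintype ι] (d : ℕ) :
    ∀ (ρ : ι → ℝ) (m : ι → ℚ), (∀ i, 0 < ρ i) → LinearIndependent ℚ ρ →
      0 < ∑ i, (m i : ℝ) * ρ i → (Finset.univ.filter fun i => m i < 0).card = d →
      ∃ ρ' : ι → ℝ, (∀ i, 0 < ρ' i) ∧ LinearIndependent ℚ ρ' ∧
        (∀ i, ρ i ∈ Submodule.span ℚ≥0 (Set.range ρ')) ∧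
        ∑ i, (m i : ℝ) * ρ i ∈ Submodule.span ℚ≥0 (Set.range ρ') := by
  classical
  induction d with
  | zero =>
    intro ρ m hρ hli _ hd
    refine ⟨ρ, hρ, hli, fun i => Submodule.subset_span ⟨i, rfl⟩, mem_span_nnrat_of_sum m fun i => ?_⟩
    by_contra hi
    have : i ∈ (Finset.univ.filter fun i => m i < 0) := by simpa using hi
    rw [Finset.card_eq_zero.1 hd] at this
    simp at this
  | succ d ih =>
    intro ρ m hρ hli hs hd
    obtain ⟨k, hk⟩ : (Finset.univ.filter fun i => m i < 0).Nonempty := by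
      rw [← Finset.card_pos]; omega
    have hk' : m k < 0 := by simpa using hk
    set Q : Finset ι := Finset.univ.filter fun i => 0 < m i with hQ
    set M : ℝ := ∑ i ∈ Q, (m i : ℝ) * ρ i with hM
    have hkQ : k ∉ Q := by simp [hQ, hk'.le]
    have hMk : -(m k : ℝ) * ρ k < M := by
      have h1 : ∑ i, (m i : ℝ) * ρ i ≤ ∑ i ∈ insert k Q, (m i : ℝ) * ρ i := by
        rw [← Finset.sum_add_sum_compl (insert k Q)]
        refine add_le_of_nonpos_right (Finset.sum_nonpos fun i hi => ?_)
        have : m i ≤ 0 := by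
          by_contra! h
          exact Finset.mem_compl.1 hi (Finset.mem_insert_of_mem (by simpa [hQ] using h))
        exact mul_nonpos_of_nonpos_of_nonneg (by exact_mod_cast this) (hρ i).le
      rw [Finset.sum_insert hkQ] at h1
      linarith
    have hMpos : 0 < M := lt_trans (mul_pos (neg_pos.2 (by exact_mod_cast hk')) (hρ k)) hMk
    have hrk := hρ k
    -- The lower bound, weighted by `m i` and summed over `Q`, makes the new coefficient at `k`
    -- nonnegative; the upper bound keeps `ρ i - c * ρ k` positive. The interval is nonempty exactly
    -- because `-m k * ρ k < M`.
    have hc : ∀ i, ∃ c : ℚ, (-(m k : ℝ) / M) * ρ i < c ∧ (c : ℝ) < ρ i / ρ k := fun i => by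
      refine exists_rat_btwn ?_
      rw [div_mul_eq_mul_div, div_lt_div_iff₀ hMpos hrk]
      have := mul_lt_mul_of_pos_left hMk (hρ i)
      linarith
    choose c0 hc1 hc2 using hc
    set c : ι → ℚ := fun i => if i ∈ Q then c0 i else 0 with hcdef
    have hck : c k = 0 := if_neg hkQ
    have hc0 : ∀ i, 0 ≤ c i := fun i => by
      by_cases hi : i ∈ Q
      · simp only [hcdef, if_pos hi]
        have : (0 : ℝ) < c0 i := lt_trans (mul_pos (div_pos (neg_pos.2 (by exact_mod_cast hk')) hMpos)
          (hρ i)) (hc1 i)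
        exact_mod_cast this.le
      · simp [hcdef, hi]
    set ρ₁ : ι → ℝ := fun i => ρ i - c i * ρ k with hρ1
    have hρ1pos : ∀ i, 0 < ρ₁ i := fun i => by
      by_cases hi : i ∈ Q
      · have := (lt_div_iff₀ hrk).1 (hc2 i)
        simp only [hρ1, hcdef, if_pos hi]; linarith
      · simp [hρ1, hcdef, hi, hρ i]
    have hρ1k : ρ₁ k = ρ k := by simp [hρ1, hck]
    have hsum : 0 ≤ m k + ∑ i, m i * c i := by
      have h1 : ∑ i, m i * c i = ∑ i ∈ Q, m i * c0 i := by
        simp [hcdef, Finset.sum_ite_mem]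
      have h2 : -(m k : ℝ) ≤ ∑ i ∈ Q, (m i : ℝ) * c0 i := by
        calc -(m k : ℝ) = (-(m k : ℝ) / M) * M := by field_simp
          _ = ∑ i ∈ Q, (m i : ℝ) * ((-(m k : ℝ) / M) * ρ i) := by
            rw [hM, Finset.mul_sum]; exact Finset.sum_congr rfl fun i _ => by ring
          _ ≤ _ := Finset.sum_le_sum fun i hi => mul_le_mul_of_nonneg_left (hc1 i).le (by
            have : 0 < m i := by simpa [hQ] using hi
            exact_mod_cast this.le)
      rw [h1]
      have : (0 : ℝ) ≤ ((m k + ∑ i ∈ Q, m i * c0 i : ℚ) : ℝ) := by push_cast; linarith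
      exact_mod_cast this
    set m₁ : ι → ℚ := fun i => if i = k then m k + ∑ i, m i * c i else m i with hm1
    have hs1 : ∑ i, (m₁ i : ℝ) * ρ₁ i = ∑ i, (m i : ℝ) * ρ i := by
      have e1 : ∀ i, (m₁ i : ℝ) * ρ₁ i
          = (m i : ℝ) * ρ i - (m i : ℝ) * c i * ρ k + if i = k then (∑ j, (m j : ℝ) * c j) * ρ k else 0 := by
        intro i
        by_cases hi : i = k
        · subst hi; simp [hm1, hρ1k, hck]; ring
        · simp [hm1, hi, hρ1]; ring
      simp_rw [e1, Finset.sum_add_distrib, Finset.sum_sub_distrib]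
      simp [Finset.sum_mul]
    have hcard : (Finset.univ.filter fun i => m₁ i < 0).card = d := by
      have : (Finset.univ.filter fun i => m₁ i < 0) = (Finset.univ.filter fun i => m i < 0).erase k := by
        ext i
        by_cases hi : i = k
        · subst hi; simp [hm1, hsum]
        · simp [hm1, hi]
      rw [this, Finset.card_erase_of_mem hk, hd]; rfl
    obtain ⟨ρ', hp, hl, hin, hsin⟩ := ih ρ₁ m₁ hρ1pos (linearIndependent_sub_smul hli k c hck)
      (by rw [hs1]; exact hs) hcard
    refine ⟨ρ', hp, hl, fun i => ?_, hs1 ▸ hsin⟩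
    have : ρ i = ρ₁ i + (c i).toNNRat • ρ₁ k := by
      rw [toNNRat_smul (hc0 i), hρ1k]
      change _ = ρ i - c i * ρ k + (c i : ℝ) * ρ k
      ring
    rw [this]
    exact Submodule.add_mem _ (hin i) (Submodule.smul_mem _ _ (hin k))

theorem exists_independent_cone (S : Finset ℝ) (hS : ∀ s ∈ S, 0 < s) :
    ∃ (τ : ℕ) (ρ : Fin τ → ℝ), (∀ i, 0 < ρ i) ∧ LinearIndependent ℚ ρ ∧
      ∀ s ∈ S, s ∈ Submodule.span ℚ≥0 (Set.range ρ) := by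
  classical
  induction S using Finset.induction_on with
  | empty => exact ⟨0, Fin.elim0, fun i => i.elim0, linearIndependent_empty_type, by simp⟩
  | insert s S _ ih =>
    obtain ⟨τ, ρ, hρ, hli, hin⟩ := ih fun s hs => hS s (Finset.mem_insert_of_mem hs)
    have hs := hS s (Finset.mem_insert_self _ _)
    by_cases hsp : s ∈ Submodule.span ℚ (Set.range ρ)
    · obtain ⟨m, rfl⟩ := (Submodule.mem_span_range_iff_exists_fun ℚ).1 hsp
      simp only [Rat.smul_def] at hs ⊢
      obtain ⟨ρ', hp, hl, h1, h2⟩ := exists_independent_cone_of_sum _ ρ m hρ hli hs rfl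
      refine ⟨τ, ρ', hp, hl, fun x hx => ?_⟩
      rcases Finset.mem_insert.1 hx with rfl | hx
      · exact h2
      · exact Submodule.span_le.2 (Set.range_subset_iff.2 h1) (hin x hx)
    · refine ⟨τ + 1, Fin.cons s ρ, fun i => Fin.cases hs hρ i,
        linearIndependent_finCons.2 ⟨hli, hsp⟩, fun x hx => ?_⟩
      rcases Finset.mem_insert.1 hx with rfl | hx
      · exact Submodule.subset_span ⟨0, rfl⟩
      · refine Submodule.span_mono (Set.range_subset_iff.2 fun i => ?_) (hin x hx)
        exact ⟨i.succ, rfl⟩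

/-- The extra factor `e` lets denominators of different elements be multiplied together into a
common one. -/
theorem exists_denominator {ι : Type*} (ρ : ι → ℝ) {x : ℝ}
    (hx : x ∈ Submodule.span ℚ≥0 (Set.range ρ)) :
    ∃ d : ℕ, 0 < d ∧ ∀ e : ℕ, 0 < e →
      x ∈ AddSubmonoid.closure (Set.range fun i => ρ i / (d * e : ℕ)) := by
  induction hx using Submodule.span_induction with
  | mem x hx =>
    obtain ⟨i, rfl⟩ := hx
    refine ⟨1, one_pos, fun e he => ?_⟩
    have : ρ i = e • (ρ i / (1 * e : ℕ)) := by
      have : (e : ℝ) ≠ 0 := by positivity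
      rw [nsmul_eq_mul]; push_cast; field_simp
    rw [this]
    refine AddSubmonoid.nsmul_mem _ (AddSubmonoid.mem_closure_of_mem ?_) _
    exact ⟨i, by simp⟩
  | zero => exact ⟨1, one_pos, fun e _ => zero_mem _⟩
  | add x y _ _ hx hy =>
    obtain ⟨d, hd, h1⟩ := hx
    obtain ⟨d', hd', h2⟩ := hy
    refine ⟨d * d', by positivity, fun e he => add_mem ?_ ?_⟩
    · have := h1 (d' * e) (by positivity); rwa [← mul_assoc] at this
    · have := h2 (d * e) (by positivity); rwa [← mul_assoc, mul_comm d' d] at this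
  | smul q x _ hx =>
    obtain ⟨d, hd, h1⟩ := hx
    refine ⟨q.den * d, mul_pos q.den_pos hd, fun e he => ?_⟩
    have hq : (q.den : ℝ) ≠ 0 := by exact_mod_cast q.den_pos.ne'
    have key : ∀ y ∈ AddSubmonoid.closure (Set.range fun i => ρ i / (d * e : ℕ)),
        y / q.den ∈ AddSubmonoid.closure (Set.range fun i => ρ i / (q.den * d * e : ℕ)) := by
      intro y hy
      induction hy using AddSubmonoid.closure_induction with
      | mem y hy =>
        obtain ⟨i, rfl⟩ := hy
        exact AddSubmonoid.mem_closure_of_mem (Set.mem_range.2 ⟨i, by push_cast; field_simp⟩)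
      | zero => simp
      | add y z _ _ hy hz => rw [add_div]; exact add_mem hy hz
    have : q • x = q.num • (x / q.den) := by
      rw [NNRat.smul_def, NNRat.cast_def, nsmul_eq_mul]; ring
    rw [this]
    exact AddSubmonoid.nsmul_mem _ (key _ (h1 e he)) _

theorem exists_common_denominator {ι : Type*} (ρ : ι → ℝ) (S : Finset ℝ)
    (hS : ∀ s ∈ S, s ∈ Submodule.span ℚ≥0 (Set.range ρ)) :
    ∃ d : ℕ, 0 < d ∧ ∀ e : ℕ, 0 < e →
      ∀ s ∈ S, s ∈ AddSubmonoid.closure (Set.range fun i => ρ i / (d * e : ℕ)) := by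
  classical
  induction S using Finset.induction_on with
  | empty => exact ⟨1, one_pos, by simp⟩
  | insert s S _ ih =>
    obtain ⟨d, hd, h1⟩ := ih fun s hs => hS s (Finset.mem_insert_of_mem hs)
    obtain ⟨d', hd', h2⟩ := exists_denominator ρ (hS s (Finset.mem_insert_self _ _))
    refine ⟨d * d', by positivity, fun e he x hx => ?_⟩
    rcases Finset.mem_insert.1 hx with rfl | hx
    · have := h2 (d * e) (by positivity); rwa [← mul_assoc, mul_comm d' d] at this
    · have := h1 (d' * e) (by positivity) x hx; rwa [← mul_assoc] at this

/-- Finitely many positive reals lie in the additive monoid generated by finitely many positive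
reals that are linearly independent over `ℤ`. -/
theorem exists_independent_generators (S : Finset ℝ) (hS : ∀ s ∈ S, 0 < s) :
    ∃ (τ : ℕ) (ρ : Fin τ → ℝ), (∀ i, 0 < ρ i) ∧ LinearIndependent ℤ ρ ∧
      (S : Set ℝ) ⊆ AddSubmonoid.closure (Set.range ρ) := by
  obtain ⟨τ, ρ, hρ, hli, hin⟩ := exists_independent_cone S hS
  obtain ⟨d, hd, h⟩ := exists_common_denominator ρ S hin
  have hd0 : (0 : ℝ) < (d * 1 : ℕ) := by simpa using hd
  refine ⟨τ, fun i => ρ i / (d * 1 : ℕ), fun i => div_pos (hρ i) hd0, ?_, fun s hs => h 1 one_pos s hs⟩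
  have hz : LinearIndependent ℤ ρ := hli.restrict_scalars' ℤ
  rw [Fintype.linearIndependent_iff] at hz ⊢
  intro g hg
  refine hz g ?_
  have : (∑ i, g i • ρ i) / (d * 1 : ℕ) = 0 := by
    rw [← hg, Finset.sum_div]
    exact Finset.sum_congr rfl fun i _ => by simp [mul_div_assoc]
  exact (div_eq_zero_iff.1 this).resolve_right hd0.ne'

theorem mem_addSubsemigroup_closure {s : Set ℝ} {x : ℝ} (hx : x ∈ AddSubmonoid.closure s)
    (h0 : x ≠ 0) : x ∈ AddSubsemigroup.closure s := by
  have : x = 0 ∨ x ∈ AddSubsemigroup.closure s := by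
    clear h0
    induction hx using AddSubmonoid.closure_induction with
    | mem x hx => exact Or.inr (AddSubsemigroup.subset_closure hx)
    | zero => exact Or.inl rfl
    | add x y _ _ hx hy =>
      rcases hx with rfl | hx
      · simpa using hy
      · rcases hy with rfl | hy
        · simpa using Or.inr hx
        · exact Or.inr (add_mem hx hy)
  exact this.resolve_left h0

/-! ### Finite generation from a recursion with a shift. -/

/-- The elements `≥ t` of a finitely generated monoid of nonnegative reals, shifted down by `t`, lie
in a finitely generated monoid of nonnegative reals. -/
theorem exists_shift_generators (T : Finset ℝ) (hT : ∀ x ∈ T, 0 < x) (t : ℝ) :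
    ∃ T' : Finset ℝ, (∀ x ∈ T', 0 < x) ∧
      ∀ a ∈ AddSubmonoid.closure (T : Set ℝ), t ≤ a → a - t ∈ AddSubmonoid.closure (T' : Set ℝ) := by
  classical
  let v : (T → ℕ) → ℝ := fun m => ∑ i, m i • (i : ℝ)
  let X : Set (T → ℕ) := {m | Minimal (fun m => t ≤ v m) m}
  -- Dickson's lemma: the minimal exponent vectors of value at least `t` form an antichain in `ℕ^T`.
  have hX : X.Finite := WellQuasiOrderedLE.finite_of_isAntichain (setOfPred_minimal_antichain _)
  refine ⟨T ∪ (hX.toFinset.image fun m => v m - t).filter (0 < ·), fun x hx => ?_, fun a ha hta => ?_⟩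
  · rcases Finset.mem_union.1 hx with hx | hx
    · exact hT x hx
    · exact (Finset.mem_filter.1 hx).2
  · obtain ⟨m, rfl⟩ := AddSubmonoid.mem_closure_finset'.1 ha
    obtain ⟨m₀, hle, hm₀⟩ := exists_minimal_le_of_wellFoundedLT (fun m => t ≤ v m) m hta
    have hsplit : ∑ i, m i • (i : ℝ) - t = (v m₀ - t) + ∑ i, (m i - m₀ i) • (i : ℝ) := by
      have : ∑ i, m i • (i : ℝ) = v m₀ + ∑ i, (m i - m₀ i) • (i : ℝ) := by
        rw [← Finset.sum_add_distrib]
        refine Finset.sum_congr rfl fun i _ => ?_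
        rw [← add_smul, Nat.add_sub_cancel' (hle i)]
      rw [this]; ring
    rw [hsplit]
    refine add_mem ?_ (sum_mem fun i _ => AddSubmonoid.nsmul_mem _
      (AddSubmonoid.mem_closure_of_mem ?_) _)
    · rcases (sub_nonneg.2 hm₀.1).eq_or_lt with h | h
      · rw [← h]; exact zero_mem _
      · refine AddSubmonoid.mem_closure_of_mem ?_
        rw [Finset.mem_coe]
        exact Finset.mem_union_right _ (Finset.mem_filter.2
          ⟨Finset.mem_image.2 ⟨m₀, hX.mem_toFinset.2 hm₀, rfl⟩, h⟩)
    · rw [Finset.mem_coe]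
      exact Finset.mem_union_left _ i.2

/-- The induction carries the stronger claim `a - ν ∈ closure T`: then two large summands of `a + ν`
already supply the `2 * ν` by which it exceeds `a - ν`. With fewer large summands the missing shift
is taken from the finitely generated small part. -/
theorem exists_generators_of_recursion {S : Set ℝ} (hS : ∀ x ∈ S, 0 < x)
    (hfin : ∀ N : ℝ, (S ∩ Set.Iic N).Finite) {s ν N : ℝ} (hs : 0 < s) (hν : 0 ≤ ν) (hN : 2 * ν ≤ N)
    (E : Finset ℝ) (hE : ∀ x ∈ E, 0 < x)
    (h : ∀ a ∈ S, N < a → a - ν ∈ AddSubmonoid.closure (E : Set ℝ) ∨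
      a + ν ∈ AddSubmonoid.closure (insert s (S ∩ Set.Iio a))) :
    ∃ T : Finset ℝ, (∀ x ∈ T, 0 < x) ∧ S ⊆ AddSubmonoid.closure (T : Set ℝ) := by
  classical
  set A : Finset ℝ := insert s (hfin N).toFinset with hA
  have hApos : ∀ x ∈ A, 0 < x := fun x hx => by
    rcases Finset.mem_insert.1 hx with rfl | hx
    · exact hs
    · exact hS x ((hfin N).mem_toFinset.1 hx).1
  have hAS : ∀ x ∈ S, x ≤ N → x ∈ A := fun x hx hxN =>
    Finset.mem_insert_of_mem ((hfin N).mem_toFinset.2 ⟨hx, hxN⟩)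
  obtain ⟨T₁, hT₁, h₁⟩ := exists_shift_generators A hApos ν
  obtain ⟨T₂, hT₂, h₂⟩ := exists_shift_generators A hApos (2 * ν)
  set T : Finset ℝ := A ∪ T₁ ∪ T₂ ∪ E ∪ ({ν} : Finset ℝ).filter (0 < ·) with hT
  have mono : ∀ {U : Finset ℝ}, U ⊆ T → ∀ {x}, x ∈ AddSubmonoid.closure (U : Set ℝ) →
      x ∈ AddSubmonoid.closure (T : Set ℝ) := fun hU x hx =>
    AddSubmonoid.closure_mono (Finset.coe_subset.2 hU) hx
  have mA : A ⊆ T := fun x hx => by simp only [hT, Finset.mem_union]; tauto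
  have m₁ : T₁ ⊆ T := fun x hx => by simp only [hT, Finset.mem_union]; tauto
  have m₂ : T₂ ⊆ T := fun x hx => by simp only [hT, Finset.mem_union]; tauto
  have mE : E ⊆ T := fun x hx => by simp only [hT, Finset.mem_union]; tauto
  have hνT : ν ∈ AddSubmonoid.closure (T : Set ℝ) := by
    rcases hν.eq_or_lt with h0 | h0
    · rw [← h0]; exact zero_mem _
    · refine AddSubmonoid.mem_closure_of_mem ?_
      rw [Finset.mem_coe]
      exact Finset.mem_union_right _ (by simp [h0])
  -- Induction on the number of elements of `S` up to `a`, finite by `hfin`.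
  have main : ∀ k : ℕ, ∀ a ∈ S, N < a → (hfin a).toFinset.card = k →
      a - ν ∈ AddSubmonoid.closure (T : Set ℝ) := by
    intro k
    induction k using Nat.strong_induction_on with
    | _ k ih =>
    intro a ha hNa hk
    have ih' : ∀ b ∈ S, N < b → b < a → b - ν ∈ AddSubmonoid.closure (T : Set ℝ) := by
      intro b hb hNb hba
      refine ih _ ?_ b hb hNb rfl
      rw [← hk]
      refine Finset.card_lt_card (Finset.ssubset_iff_of_subset (fun x hx => ?_) |>.2
        ⟨a, (hfin a).mem_toFinset.2 ⟨ha, Set.mem_Iic.2 le_rfl⟩, fun hx => ?_⟩)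
      · have := (hfin b).mem_toFinset.1 hx
        exact (hfin a).mem_toFinset.2 ⟨this.1, Set.mem_Iic.2 (le_trans (Set.mem_Iic.1 this.2) hba.le)⟩
      · exact absurd ((hfin b).mem_toFinset.1 hx).2 (not_le.2 hba)
    rcases h a ha hNa with h | h
    · exact mono mE h
    -- The three cases are no summand above `N`, exactly one, or enough shift gained from at least
    -- two.
    have key : ∀ x ∈ AddSubmonoid.closure (insert s (S ∩ Set.Iio a)),
        x ∈ AddSubmonoid.closure (A : Set ℝ) ∨
        (∃ c ∈ AddSubmonoid.closure (A : Set ℝ), ∃ b ∈ S, N < b ∧ b < a ∧ x = c + b) ∨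
        x - 2 * ν ∈ AddSubmonoid.closure (T : Set ℝ) := by
      intro x hx
      induction hx using AddSubmonoid.closure_induction_left with
      | zero => exact Or.inl (zero_mem _)
      | add_left g hg y _ hy =>
        have hg' : g ∈ A ∨ g ∈ S ∧ N < g ∧ g < a := by
          rcases hg with rfl | hg
          · exact Or.inl (Finset.mem_insert_self _ _)
          · rcases le_or_gt g N with hgN | hgN
            · exact Or.inl (hAS g hg.1 hgN)
            · exact Or.inr ⟨hg.1, hgN, hg.2⟩
        rcases hg' with hg | ⟨hg, hgN, hga⟩
        · have hgA : g ∈ AddSubmonoid.closure (A : Set ℝ) :=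
            AddSubmonoid.mem_closure_of_mem (Finset.mem_coe.2 hg)
          rcases hy with hy | ⟨c, hc, b, hb, hNb, hba, rfl⟩ | hy
          · exact Or.inl (add_mem hgA hy)
          · exact Or.inr (Or.inl ⟨g + c, add_mem hgA hc, b, hb, hNb, hba, by ring⟩)
          · exact Or.inr (Or.inr (by rw [add_sub_assoc]; exact add_mem (mono mA hgA) hy))
        · have hgT := ih' g hg hgN hga
          rcases hy with hy | ⟨c, hc, b, hb, hNb, hba, rfl⟩ | hy
          · exact Or.inr (Or.inl ⟨y, hy, g, hg, hgN, hga, by ring⟩)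
          · refine Or.inr (Or.inr ?_)
            have : g + (c + b) - 2 * ν = (g - ν) + (b - ν) + c := by ring
            rw [this]
            exact add_mem (add_mem hgT (ih' b hb hNb hba)) (mono mA hc)
          · refine Or.inr (Or.inr ?_)
            have : g + y - 2 * ν = (g - ν) + ν + (y - 2 * ν) := by ring
            rw [this]
            exact add_mem (add_mem hgT hνT) hy
    -- With a single large summand `b < a`, the rest `c = a + ν - b` exceeds `ν`, so `c - ν` is
    -- available from `T₁`.
    rcases key _ h with hc | ⟨c, hc, b, hb, hNb, hba, he⟩ | hc
    · have := h₂ _ hc (by linarith)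
      have e : a + ν - 2 * ν = a - ν := by ring
      exact mono m₂ (e ▸ this)
    · have := h₁ _ hc (by linarith)
      have e : a - ν = (c - ν) + (b - ν) := by linarith
      rw [e]
      exact add_mem (mono m₁ this) (ih' b hb hNb hba)
    · have e : a + ν - 2 * ν = a - ν := by ring
      exact e ▸ hc
  refine ⟨T, fun x hx => ?_, fun x hx => ?_⟩
  · simp only [hT, Finset.mem_union, Finset.mem_filter, Finset.mem_singleton] at hx
    rcases hx with (((hx | hx) | hx) | hx) | hx
    exacts [hApos x hx, hT₁ x hx, hT₂ x hx, hE x hx, hx.2]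
  · rcases le_or_gt x N with hxN | hxN
    · exact mono mA (AddSubmonoid.mem_closure_of_mem (Finset.mem_coe.2 (hAS x hx hxN)))
    · have := add_mem (main _ x hx hxN rfl) hνT
      simpa using this

/-! ### Exponents on which the multiplier takes a given value. -/

/-- The part above `t` of a set of reals contained in a residue class modulo `e`. -/
theorem exists_generators_of_residueClass {X : Set ℝ} {e : ℝ} (he : 0 ≤ e)
    (hX : ∀ x ∈ X, ∀ y ∈ X, ∃ k : ℤ, x - y = k * e) (t : ℝ) :
    ∃ T : Finset ℝ, (∀ x ∈ T, 0 < x) ∧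
      ∀ x ∈ X, t < x → x - t ∈ AddSubmonoid.closure (T : Set ℝ) := by
  classical
  by_cases hne : ∃ r ∈ X, t < r
  · obtain ⟨r, hr, htr⟩ := hne
    rcases he.eq_or_lt with rfl | he
    · refine ⟨{r - t}, by simpa using htr, fun x hx _ => ?_⟩
      obtain ⟨k, hk⟩ := hX x hx r hr
      have : x = r := by simpa [sub_eq_zero] using hk
      subst this
      exact AddSubmonoid.mem_closure_of_mem (by simp)
    -- The representative of `r` modulo `e` in `(t, t + e]`; it need not belong to `X`.
    · set r₀ : ℝ := r - (⌈(r - t) / e⌉ - 1 : ℤ) * e with hr₀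
      have h1 : t < r₀ := by
        have := mul_lt_mul_of_pos_right (Int.ceil_lt_add_one ((r - t) / e)) he
        rw [add_mul, div_mul_cancel₀ _ he.ne'] at this
        rw [hr₀]; push_cast; linarith
      have h2 : r₀ ≤ t + e := by
        have := mul_le_mul_of_nonneg_right (Int.le_ceil ((r - t) / e)) he.le
        rw [div_mul_cancel₀ _ he.ne'] at this
        rw [hr₀]; push_cast; linarith
      refine ⟨{r₀ - t, e}, by simp [h1, he], fun x hx htx => ?_⟩
      obtain ⟨k, hk⟩ := hX x hx r hr
      set k' : ℤ := k + (⌈(r - t) / e⌉ - 1) with hk'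
      have h3 : x = r₀ + k' * e := by rw [hr₀, hk']; push_cast; linarith
      have h4 : 0 ≤ k' := by
        by_contra! hneg
        have : (k' : ℝ) ≤ -1 := by exact_mod_cast (by omega : k' ≤ -1)
        nlinarith
      obtain ⟨j, hj⟩ := Int.eq_ofNat_of_zero_le h4
      have h5 : x - t = (r₀ - t) + j • e := by
        rw [h3, hj, nsmul_eq_mul]; push_cast; ring
      rw [h5]
      exact add_mem (AddSubmonoid.mem_closure_of_mem (by simp))
        (AddSubmonoid.nsmul_mem _ (AddSubmonoid.mem_closure_of_mem (by simp)) _)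
  · push Not at hne
    exact ⟨∅, by simp, fun x hx htx => absurd htx (not_lt.2 (hne x hx))⟩

/-- Two solutions differ by a real integer multiple of `2πi / L`, hence by that multiple of its real
part. If this real part is zero, there is at most one solution and `e = 0`. -/
theorem exp_mul_eq_residueClass {L : ℂ} (hL : L ≠ 0) (r : ℂ) :
    ∃ e : ℝ, 0 ≤ e ∧ ∀ x ∈ {a : ℝ | Complex.exp (a * L) = r},
      ∀ y ∈ {a : ℝ | Complex.exp (a * L) = r}, ∃ k : ℤ, x - y = k * e := by
  refine ⟨|(2 * Real.pi * Complex.I / L).re|, abs_nonneg _, fun x hx y hy => ?_⟩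
  obtain ⟨k, hk⟩ := Complex.exp_eq_exp_iff_exists_int.1 (hx.trans hy.symm)
  have h1 : ((x - y : ℝ) : ℂ) = (k : ℝ) * (2 * Real.pi * Complex.I / L) := by
    push_cast; field_simp; linear_combination hk
  have h2 : x - y = k * (2 * Real.pi * Complex.I / L).re := by
    have := congrArg Complex.re h1
    rwa [Complex.ofReal_re, Complex.re_ofReal_mul] at this
  rcases abs_choice (2 * Real.pi * Complex.I / L).re with h | h
  · exact ⟨k, by rw [h, h2]⟩
  · exact ⟨-k, by rw [h, h2]; push_cast; ring⟩

/-- The multiplier `w` takes each value on a set of exponents whose part above any `t`, shifted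
down by `t`, lies in a finitely generated monoid of nonnegative reals. -/
def HasFGFibers (w : ℝ → ℂ) : Prop :=
  ∀ (r : ℂ) (t : ℝ), ∃ T : Finset ℝ, (∀ x ∈ T, 0 < x) ∧
    ∀ x : ℝ, w x = r → t < x → x - t ∈ AddSubmonoid.closure (T : Set ℝ)

theorem hasFGFibers_ofReal : HasFGFibers fun a => (a : ℂ) := fun r t =>
  exists_generators_of_residueClass (X := {a : ℝ | (a : ℂ) = r}) le_rfl
    (fun x hx y hy => ⟨0, by
      have : (x : ℂ) = y := hx.trans hy.symm
      simp [Complex.ofReal_injective this]⟩) t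

theorem hasFGFibers_exp {L : ℂ} (hL : L ≠ 0) : HasFGFibers fun a => Complex.exp (a * L) := by
  intro r t
  obtain ⟨e, he, h⟩ := exp_mul_eq_residueClass hL r
  exact exists_generators_of_residueClass he h t

theorem HasFGFibers.exists_generators_of_isRoot {w : ℝ → ℂ} (hw : HasFGFibers w)
    {p : Polynomial ℂ} (hp : p ≠ 0) (t : ℝ) :
    ∃ T : Finset ℝ, (∀ x ∈ T, 0 < x) ∧
      ∀ x : ℝ, p.eval (w x) = 0 → t < x → x - t ∈ AddSubmonoid.closure (T : Set ℝ) := by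
  classical
  choose T hT h using fun r => hw r t
  refine ⟨p.roots.toFinset.biUnion T, fun x hx => ?_, fun x hx htx => ?_⟩
  · obtain ⟨r, _, hr⟩ := Finset.mem_biUnion.1 hx
    exact hT r x hr
  · refine AddSubmonoid.closure_mono ?_ (h (w x) x rfl htx)
    exact Finset.coe_subset.2 (Finset.subset_biUnion_of_mem T (by simpa [hp] using hx))

/-! ### A nonzero analytic germ has a nonzero Taylor series. -/

/-- A Taylor coefficient records the derivative on one arbitrary ordering of its multi-index;
symmetry of the iterated derivative reaches every other ordering. -/
theorem iteratedFDeriv_single_eq_zero_of_taylorSeries_eq_zero {m : ℕ} {F : (Fin m → ℂ) → ℂ}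
    (hF : AnalyticAt ℂ F 0) (h : taylorSeries F = 0) (n : ℕ) (v : Fin n → Fin m) :
    iteratedFDeriv ℂ n F 0 (fun k => Pi.single (v k) 1) = 0 := by
  classical
  set p : Fin m →₀ ℕ := Multiset.toFinsupp (List.ofFn v : Multiset (Fin m)) with hp
  have hperm : (List.ofFn v).Perm p.toMultiset.toList := by
    rw [← Multiset.coe_eq_coe, Multiset.coe_toList, hp, Multiset.toFinsupp_toMultiset]
  have hcoef : (∏ i, ((p i).factorial : ℂ))⁻¹ *
      iteratedFDeriv ℂ p.toMultiset.toList.length F 0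
        (fun k => Pi.single (p.toMultiset.toList.get k) 1) = 0 := congrFun h p
  have hfac : (∏ i, ((p i).factorial : ℂ))⁻¹ ≠ 0 :=
    inv_ne_zero (Finset.prod_ne_zero_iff.2 fun i _ => by exact_mod_cast (p i).factorial_ne_zero)
  have hz := (mul_eq_zero.1 hcoef).resolve_left hfac
  generalize p.toMultiset.toList = l at hperm hz
  have hlen : l.length = n := by rw [← hperm.length_eq, List.length_ofFn]
  obtain ⟨u, rfl⟩ : ∃ u : Fin n → Fin m, l = List.ofFn u := by
    subst hlen; exact ⟨l.get, (List.ofFn_get l).symm⟩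
  have hz' : iteratedFDeriv ℂ n F 0 (fun k => Pi.single (u k) 1) = 0 := by
    clear hcoef hperm
    have key : ∀ (N : ℕ) (hN : N = n) (g : Fin N → Fin m), (∀ k, g k = u (Fin.cast hN k)) →
        iteratedFDeriv ℂ N F 0 (fun k => Pi.single (g k) 1) = 0 →
        iteratedFDeriv ℂ n F 0 (fun k => Pi.single (u k) 1) = 0 := by
      intro N hN g hg h
      subst hN
      simpa [hg] using h
    exact key _ hlen _ (fun k => by rw [List.get_ofFn]) hz
  -- Lists that are permutations of each other have the same sorted form, so composing the two
  -- sorting permutations gives `σ`.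
  obtain ⟨σ, hσ⟩ : ∃ σ : Equiv.Perm (Fin n), v = u ∘ σ := by
    have h1 : List.ofFn (v ∘ Tuple.sort v) = List.ofFn (u ∘ Tuple.sort u) :=
      (((Tuple.sort v).ofFn_comp_perm v).trans
        (hperm.trans ((Tuple.sort u).ofFn_comp_perm u).symm)).eq_of_sortedLE
        (Tuple.monotone_sort v).sortedLE_ofFn (Tuple.monotone_sort u).sortedLE_ofFn
    refine ⟨(Tuple.sort v).symm.trans (Tuple.sort u), funext fun k => ?_⟩
    have h2 := congrFun (List.ofFn_injective h1) ((Tuple.sort v).symm k)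
    simpa using h2
  have := (hF.contDiffAt (n := ⊤)).iteratedFDeriv_comp_perm
    (fun k => (Pi.single (u k) 1 : Fin m → ℂ)) σ
  rw [hσ]
  exact this.trans hz'

theorem taylorSeries_ne_zero {m : ℕ} {F : (Fin m → ℂ) → ℂ}
    (hF : AnalyticAt ℂ F 0) (hF0 : ¬ F =ᶠ[𝓝 0] 0) : taylorSeries F ≠ 0 := by
  intro h
  have hz : ∀ n, iteratedFDeriv ℂ n F 0 = 0 := fun n => by
    apply ContinuousMultilinearMap.toMultilinearMap_injective
    refine Module.Basis.ext_multilinear (fun _ => Pi.basisFun ℂ (Fin m)) fun v => ?_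
    simp only [Pi.basisFun_apply]
    exact iteratedFDeriv_single_eq_zero_of_taylorSeries_eq_zero hF h n v
  obtain ⟨q, r, hq⟩ := hF
  refine hF0 ?_
  filter_upwards [Metric.eball_mem_nhds (0 : Fin m → ℂ) hq.r_pos] with y hy
  have hs := hq.hasSum_iteratedFDeriv hy
  rw [zero_add] at hs
  refine hs.unique ?_
  have : (fun n : ℕ => ((n.factorial : ℂ))⁻¹ • iteratedFDeriv ℂ n F 0 fun _ => y) = fun _ => 0 := by
    funext n
    rw [hz n, zero_apply, smul_zero]
  rw [this]
  exact hasSum_zero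

/-! ### Substitution of Hahn series into power series, and its Taylor expansion. -/

/-- Hahn series all of whose exponents are `≥ t`. -/
def ordGE (t : ℝ) : AddSubgroup (HahnSeries ℝ ℂ) where
  carrier := {x | ∀ a < t, x.coeff a = 0}
  add_mem' hx hy a ha := by simp [hx a ha, hy a ha]
  zero_mem' a _ := rfl
  neg_mem' hx a ha := by simp [hx a ha]

theorem mem_ordGE_iff_support {t : ℝ} {x : HahnSeries ℝ ℂ} :
    x ∈ ordGE t ↔ x.support ⊆ Set.Ici t := by
  refine ⟨fun h a ha => ?_, fun h a ha => ?_⟩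
  · by_contra hlt
    exact ha (h a (not_le.1 hlt))
  · by_contra hne
    exact absurd (h hne) (not_le.2 ha)

theorem ordGE_anti {s t : ℝ} (h : s ≤ t) : ordGE t ≤ ordGE s := fun _ hx a ha =>
  hx a (ha.trans_le h)

theorem mul_mem_ordGE {s t : ℝ} {x y : HahnSeries ℝ ℂ} (hx : x ∈ ordGE s) (hy : y ∈ ordGE t) :
    x * y ∈ ordGE (s + t) :=
  mem_ordGE_iff_support.2 (support_mul_le (mem_ordGE_iff_support.1 hx) (mem_ordGE_iff_support.1 hy))

theorem coeff_C_mul_apply (c : ℂ) (x : HahnSeries ℝ ℂ) (a : ℝ) :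
    (HahnSeries.C c * x).coeff a = c * x.coeff a := by
  rw [HahnSeries.C_mul_eq_smul, HahnSeries.coeff_smul, smul_eq_mul]

theorem C_mul_mem_ordGE {t : ℝ} (c : ℂ) {x : HahnSeries ℝ ℂ} (hx : x ∈ ordGE t) :
    HahnSeries.C c * x ∈ ordGE t := fun a ha => by rw [coeff_C_mul_apply, hx a ha, mul_zero]

theorem eq_zero_of_forall_mem_ordGE {ε : ℝ} (hε : 0 < ε) {x : HahnSeries ℝ ℂ}
    (h : ∀ K : ℕ, x ∈ ordGE (K * ε)) : x = 0 := by
  ext a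
  obtain ⟨K, hK⟩ := exists_nat_gt (a / ε)
  exact h K a ((div_lt_iff₀ hε).1 hK)

theorem exists_mem_ordGE {m : ℕ} (Φ : Fin m → HahnSeries ℝ ℂ)
    (hΦ : ∀ i, (Φ i).support ⊆ Set.Ioi 0) : ∃ ε : ℝ, 0 < ε ∧ ∀ i, Φ i ∈ ordGE ε := by
  choose ε hε h using fun i => exists_le_support (hΦ i)
  by_cases hm : Nonempty (Fin m)
  · obtain ⟨i₀, hi₀⟩ := Finite.exists_min ε
    exact ⟨ε i₀, hε i₀, fun i => ordGE_anti (hi₀ i) (mem_ordGE_iff_support.2 (h i))⟩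
  · exact ⟨1, one_pos, fun i => (hm ⟨i⟩).elim⟩

theorem support_prod_pow_subset_closure {m : ℕ} (Φ : Fin m → HahnSeries ℝ ℂ) (p : Fin m →₀ ℕ) :
    (∏ i, Φ i ^ p i).support ⊆ AddSubmonoid.closure (⋃ i, (Φ i).support) := by
  have hone : (1 : HahnSeries ℝ ℂ).support ⊆ AddSubmonoid.closure (⋃ i, (Φ i).support) := by
    intro a ha
    have : a = 0 := HahnSeries.support_single_subset ha
    rw [this]; exact zero_mem _
  have hmul : ∀ x y : HahnSeries ℝ ℂ, x.support ⊆ AddSubmonoid.closure (⋃ i, (Φ i).support) →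
      y.support ⊆ AddSubmonoid.closure (⋃ i, (Φ i).support) →
      (x * y).support ⊆ AddSubmonoid.closure (⋃ i, (Φ i).support) := by
    intro x y hx hy a ha
    obtain ⟨b, hb, c, hc, rfl⟩ := HahnSeries.support_mul_subset ha
    exact add_mem (hx hb) (hy hc)
  refine Finset.prod_induction _ (fun x : HahnSeries ℝ ℂ =>
    x.support ⊆ AddSubmonoid.closure (⋃ i, (Φ i).support)) hmul hone fun i _ => ?_
  induction p i with
  | zero => rw [pow_zero]; exact hone
  | succ k ih =>
    rw [pow_succ]
    exact hmul _ _ ih fun a ha => AddSubmonoid.mem_closure_of_mem (Set.mem_iUnion.2 ⟨i, ha⟩)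

theorem exists_of_substCoeff_ne_zero {m : ℕ} {P : MvPowerSeries (Fin m) ℂ}
    {Φ : Fin m → HahnSeries ℝ ℂ} {a : ℝ} (h : substCoeff P Φ a ≠ 0) :
    ∃ p, MvPowerSeries.coeff p P ≠ 0 ∧ (∏ i, Φ i ^ p i).coeff a ≠ 0 := by
  obtain ⟨p, hp⟩ : ∃ p : Fin m →₀ ℕ,
      MvPowerSeries.coeff p P * (∏ i, Φ i ^ p i).coeff a ≠ 0 := by
    by_contra! hz
    exact h (finsum_eq_zero_of_forall_eq_zero hz)
  exact ⟨p, left_ne_zero_of_mul hp, right_ne_zero_of_mul hp⟩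

theorem support_substCoeff_subset {m : ℕ} (P : MvPowerSeries (Fin m) ℂ)
    (Φ : Fin m → HahnSeries ℝ ℂ) :
    Function.support (substCoeff P Φ) ⊆ AddSubmonoid.closure (⋃ i, (Φ i).support) := fun a ha => by
  obtain ⟨p, -, hp⟩ := exists_of_substCoeff_ne_zero ha
  exact support_prod_pow_subset_closure Φ p hp

/-- The substitution of Hahn series with positive exponents into a formal power series. -/
def evalSeries {m : ℕ} (Φ : Fin m → HahnSeries ℝ ℂ) (hΦ : ∀ i, (Φ i).support ⊆ Set.Ioi 0)
    (P : MvPowerSeries (Fin m) ℂ) : HahnSeries ℝ ℂ where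
  coeff := substCoeff P Φ
  isPWO_support' := by
    refine Set.IsPWO.mono ?_ (support_substCoeff_subset P Φ)
    refine Set.IsPWO.addSubmonoid_closure (fun a ha => ?_) ?_
    · obtain ⟨i, hi⟩ := Set.mem_iUnion.1 ha
      exact (hΦ i hi).le
    · have : ⋃ i, (Φ i).support = ⋃ i ∈ (Finset.univ : Finset (Fin m)), (Φ i).support := by simp
      rw [this]
      exact (Finset.isPWO_bUnion _).2 fun i _ => (Φ i).isPWO_support

section Evaluation

variable {m : ℕ} {Φ : Fin m → HahnSeries ℝ ℂ} (hΦ : ∀ i, (Φ i).support ⊆ Set.Ioi 0)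

theorem finite_support_substCoeff (hΦ : ∀ i, (Φ i).support ⊆ Set.Ioi 0)
    (P : MvPowerSeries (Fin m) ℂ) (a : ℝ) :
    (Function.support fun p : Fin m →₀ ℕ =>
      MvPowerSeries.coeff p P * (∏ i, Φ i ^ p i).coeff a).Finite :=
  (finite_substCoeff Φ hΦ a).subset fun _ hp => right_ne_zero_of_mul hp

theorem evalSeries_add (P Q : MvPowerSeries (Fin m) ℂ) :
    evalSeries Φ hΦ (P + Q) = evalSeries Φ hΦ P + evalSeries Φ hΦ Q := by
  ext a
  change substCoeff _ _ _ = substCoeff _ _ _ + substCoeff _ _ _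
  unfold substCoeff
  rw [← finsum_add_distrib (finite_support_substCoeff hΦ P a) (finite_support_substCoeff hΦ Q a)]
  simp [add_mul]

theorem evalSeries_smul (c : ℂ) (P : MvPowerSeries (Fin m) ℂ) :
    evalSeries Φ hΦ (c • P) = HahnSeries.C c * evalSeries Φ hΦ P := by
  ext a
  rw [coeff_C_mul_apply]
  change substCoeff _ _ _ = c * substCoeff _ _ _
  unfold substCoeff
  rw [mul_finsum]
  simp [mul_assoc]

theorem evalSeries_zero : evalSeries Φ hΦ 0 = 0 := by
  ext a
  change substCoeff _ _ _ = 0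
  simp [substCoeff]

theorem evalSeries_coe (q : MvPolynomial (Fin m) ℂ) :
    evalSeries Φ hΦ (q : MvPowerSeries (Fin m) ℂ) = MvPolynomial.eval₂Hom HahnSeries.C Φ q := by
  ext a
  change substCoeff _ _ _ = _
  unfold substCoeff
  rw [finsum_eq_sum_of_support_subset (s := q.support), MvPolynomial.coe_eval₂Hom,
    MvPolynomial.eval₂_eq', HahnSeries.coeff_sum]
  · refine Finset.sum_congr rfl fun p _ => ?_
    rw [MvPolynomial.coeff_coe, coeff_C_mul_apply]
  · intro p hp
    have := left_ne_zero_of_mul hp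
    rw [MvPolynomial.coeff_coe] at this
    exact MvPolynomial.mem_support_iff.2 this

theorem evalSeries_mem_ordGE {ε : ℝ} (hε : 0 ≤ ε) (hΦε : ∀ i, Φ i ∈ ordGE ε)
    {P : MvPowerSeries (Fin m) ℂ} {K : ℕ}
    (hP : ∀ p : Fin m →₀ ℕ, p.degree < K → MvPowerSeries.coeff p P = 0) :
    evalSeries Φ hΦ P ∈ ordGE (K * ε) := by
  intro a ha
  by_contra hne
  obtain ⟨p, hp, hpa⟩ := exists_of_substCoeff_ne_zero hne
  have h1 : ∑ i, (p i : ℝ) * ε ≤ a :=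
    support_prod_le Finset.univ (fun i => Φ i ^ p i) (fun i => p i * ε)
      (fun i _ => support_pow_le (mem_ordGE_iff_support.1 (hΦε i)) (p i)) hpa
  have h2 : K ≤ p.degree := not_lt.1 fun h => hp (hP p h)
  rw [← Finset.sum_mul, ← Nat.cast_sum] at h1
  rw [Finsupp.degree_eq_sum] at h2
  have : (K : ℝ) * ε ≤ (∑ i, p i : ℕ) * ε := mul_le_mul_of_nonneg_right (by exact_mod_cast h2) hε
  linarith

theorem evalSeries_mem_ordGE_zero (P : MvPowerSeries (Fin m) ℂ) :
    evalSeries Φ hΦ P ∈ ordGE 0 := by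
  obtain ⟨ε, hε, h⟩ := exists_mem_ordGE Φ hΦ
  simpa using evalSeries_mem_ordGE hΦ hε.le h (P := P) (K := 0) (by simp)

theorem exists_eq_polynomial_add (P : MvPowerSeries (Fin m) ℂ) (K : ℕ) :
    ∃ (q : MvPolynomial (Fin m) ℂ) (R : MvPowerSeries (Fin m) ℂ), P = q + R ∧
      ∀ p : Fin m →₀ ℕ, p.degree < K → MvPowerSeries.coeff p R = 0 := by
  refine ⟨P.truncTotal K, P - P.truncTotal K, by ring, fun p hp => ?_⟩
  rw [map_sub, MvPolynomial.coeff_coe, MvPowerSeries.coeff_truncTotal P hp, sub_self]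

/-- The identity is clear for polynomials, and truncating `P` at total degree `K` changes both sides
only at order `K * ε` or higher. -/
theorem evalSeries_mul_X (P : MvPowerSeries (Fin m) ℂ) (i : Fin m) :
    evalSeries Φ hΦ (P * MvPowerSeries.X i) = evalSeries Φ hΦ P * Φ i := by
  obtain ⟨ε, hε, h⟩ := exists_mem_ordGE Φ hΦ
  rw [← sub_eq_zero]
  refine eq_zero_of_forall_mem_ordGE hε fun K => ?_
  obtain ⟨q, R, rfl, hR⟩ := exists_eq_polynomial_add P K
  have e : ((q : MvPowerSeries (Fin m) ℂ) + R) * MvPowerSeries.X i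
      = ((q * MvPolynomial.X i : MvPolynomial (Fin m) ℂ) : MvPowerSeries (Fin m) ℂ)
        + R * MvPowerSeries.X i := by
    rw [MvPolynomial.coe_mul, MvPolynomial.coe_X]; ring
  rw [e, evalSeries_add, evalSeries_add, evalSeries_coe, evalSeries_coe, map_mul,
    MvPolynomial.eval₂Hom_X', add_mul, add_sub_add_left_eq_sub]
  refine sub_mem (evalSeries_mem_ordGE hΦ hε.le h fun p hp => ?_) ?_
  · rw [MvPowerSeries.coeff_mul]
    refine Finset.sum_eq_zero fun x hx => ?_
    rw [hR x.1, zero_mul]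
    refine lt_of_le_of_lt ?_ hp
    rw [← Finset.HasAntidiagonal.mem_antidiagonal.1 hx, map_add]
    exact Nat.le_add_right _ _
  · exact ordGE_anti (by linarith [hε]) (mul_mem_ordGE (evalSeries_mem_ordGE hΦ hε.le h hR) (h i))

theorem evalSeries_congr {Φ' : Fin m → HahnSeries ℝ ℂ} (hΦ' : ∀ i, (Φ' i).support ⊆ Set.Ioi 0)
    {P : MvPowerSeries (Fin m) ℂ}
    (h : ∀ p, MvPowerSeries.coeff p P ≠ 0 → ∀ i, p i ≠ 0 → Φ i = Φ' i) :
    evalSeries Φ hΦ P = evalSeries Φ' hΦ' P := by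
  ext a
  refine finsum_congr fun p => ?_
  by_cases hp : MvPowerSeries.coeff p P = 0
  · simp [hp]
  · congr 2
    refine Finset.prod_congr rfl fun i _ => ?_
    by_cases hi : p i = 0
    · simp [hi]
    · rw [h p hp i hi]

/-- First-order Taylor expansion of the substitution, with quadratic error. -/
theorem evalSeries_taylor {Φ' : Fin m → HahnSeries ℝ ℂ} (hΦ' : ∀ i, (Φ' i).support ⊆ Set.Ioi 0)
    {t : ℝ} (ht : 0 ≤ t) (hΨ : ∀ i, Φ' i - Φ i ∈ ordGE t) (P : MvPowerSeries (Fin m) ℂ) :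
    evalSeries Φ' hΦ' P - evalSeries Φ hΦ P -
      ∑ i, evalSeries Φ hΦ (MvPowerSeries.pderiv ℂ i P) * (Φ' i - Φ i) ∈ ordGE (2 * t) := by
  classical
  obtain ⟨ε, hε, h⟩ := exists_mem_ordGE Φ hΦ
  obtain ⟨ε', hε', h'⟩ := exists_mem_ordGE Φ' hΦ'
  obtain ⟨K, hK⟩ := exists_nat_gt (2 * t / min ε ε')
  have hKε : 2 * t < K * min ε ε' := (div_lt_iff₀ (lt_min hε hε')).1 hK
  have h1 : 2 * t < K * ε := hKε.trans_le
    (mul_le_mul_of_nonneg_left (min_le_left _ _) (Nat.cast_nonneg _))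
  have h2 : 2 * t < K * ε' := hKε.trans_le
    (mul_le_mul_of_nonneg_left (min_le_right _ _) (Nat.cast_nonneg _))
  -- One degree more than `R` itself requires, because its derivatives lose one degree.
  obtain ⟨q, R, rfl, hR⟩ := exists_eq_polynomial_add P (K + 1)
  have hder : ∀ i, ∀ p : Fin m →₀ ℕ, p.degree < K →
      MvPowerSeries.coeff p (MvPowerSeries.pderiv ℂ i R) = 0 := fun i p hp => by
    rw [MvPowerSeries.coeff_pderiv, hR, zero_mul]
    rw [map_add, Finsupp.degree_single]; omega
  have hpol : MvPolynomial.eval₂Hom HahnSeries.C Φ' q - MvPolynomial.eval₂Hom HahnSeries.C Φ q -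
      ∑ i, MvPolynomial.eval₂Hom HahnSeries.C Φ (MvPolynomial.pderiv i q) * (Φ' i - Φ i) ∈ ordGE (2 * t) := by
    induction q using MvPolynomial.induction_on with
    | C c => simp
    | add q r hq hr =>
      convert add_mem hq hr using 1
      simp only [map_add, add_mul, Finset.sum_add_distrib]
      ring
    | mul_X q k hq =>
      -- By the Leibniz rule the new error is the old error times `Φ' k`, plus the old linear part
      -- times the increment of the `k`-th variable, which is quadratic in the increments.
      have e : MvPolynomial.eval₂Hom HahnSeries.C Φ' (q * MvPolynomial.X k) - MvPolynomial.eval₂Hom HahnSeries.C Φ (q * MvPolynomial.X k) -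
          ∑ i, MvPolynomial.eval₂Hom HahnSeries.C Φ (MvPolynomial.pderiv i (q * MvPolynomial.X k)) * (Φ' i - Φ i) =
          (MvPolynomial.eval₂Hom HahnSeries.C Φ' q - MvPolynomial.eval₂Hom HahnSeries.C Φ q -
            ∑ i, MvPolynomial.eval₂Hom HahnSeries.C Φ (MvPolynomial.pderiv i q) * (Φ' i - Φ i)) * Φ' k +
          (∑ i, MvPolynomial.eval₂Hom HahnSeries.C Φ (MvPolynomial.pderiv i q) * (Φ' i - Φ i)) * (Φ' k - Φ k) := by
        have : ∑ i, MvPolynomial.eval₂Hom HahnSeries.C Φ (MvPolynomial.pderiv i (q * MvPolynomial.X k)) * (Φ' i - Φ i)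
            = (∑ i, MvPolynomial.eval₂Hom HahnSeries.C Φ (MvPolynomial.pderiv i q) * (Φ' i - Φ i)) * Φ k
              + MvPolynomial.eval₂Hom HahnSeries.C Φ q * (Φ' k - Φ k) := by
          simp only [MvPolynomial.pderiv_mul, MvPolynomial.pderiv_X, map_add, map_mul,
            MvPolynomial.eval₂Hom_X', add_mul, Finset.sum_add_distrib]
          congr 1
          · rw [Finset.sum_mul]; exact Finset.sum_congr rfl fun i _ => by ring
          · rw [Finset.sum_eq_single k]
            · simp
            · intro i _ hi; simp [hi.symm]
            · simp
        rw [this, map_mul, map_mul, MvPolynomial.eval₂Hom_X', MvPolynomial.eval₂Hom_X']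
        ring
      rw [e]
      refine add_mem (ordGE_anti (by linarith) (mul_mem_ordGE hq (h' k))) ?_
      refine ordGE_anti (by linarith : 2 * t ≤ t + t) (mul_mem_ordGE (sum_mem fun i _ => ?_) (hΨ k))
      rw [← evalSeries_coe hΦ]
      exact ordGE_anti (by linarith) (mul_mem_ordGE (evalSeries_mem_ordGE_zero hΦ _) (hΨ i))
  have e : evalSeries Φ' hΦ' (q + R) - evalSeries Φ hΦ (q + R) -
      ∑ i, evalSeries Φ hΦ (MvPowerSeries.pderiv ℂ i (q + R)) * (Φ' i - Φ i) =
      (MvPolynomial.eval₂Hom HahnSeries.C Φ' q - MvPolynomial.eval₂Hom HahnSeries.C Φ q -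
        ∑ i, MvPolynomial.eval₂Hom HahnSeries.C Φ (MvPolynomial.pderiv i q) * (Φ' i - Φ i)) +
      (evalSeries Φ' hΦ' R - evalSeries Φ hΦ R -
        ∑ i, evalSeries Φ hΦ (MvPowerSeries.pderiv ℂ i R) * (Φ' i - Φ i)) := by
    simp only [evalSeries_add, map_add, MvPowerSeries.pderiv_coe, evalSeries_coe, add_mul,
      Finset.sum_add_distrib]
    ring
  rw [e]
  refine add_mem hpol (sub_mem (sub_mem ?_ ?_) (sum_mem fun i _ => ?_))
  · exact ordGE_anti (by push_cast; linarith) (evalSeries_mem_ordGE hΦ' hε'.le h' hR)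
  · exact ordGE_anti (by push_cast; linarith) (evalSeries_mem_ordGE hΦ hε.le h hR)
  · exact ordGE_anti (by linarith)
      (mul_mem_ordGE (evalSeries_mem_ordGE hΦ hε.le h (hder i)) (hΨ i))

end Evaluation

/-! ### Manufacturing a regular relation. -/

section Selection

variable {m : ℕ} {Φ : Fin m → HahnSeries ℝ ℂ} (hΦ : ∀ i, (Φ i).support ⊆ Set.Ioi 0)

/-- The coefficient of the `k`-th power of the `j`-th variable. -/
def slice (j : Fin m) (k : ℕ) (P : MvPowerSeries (Fin m) ℂ) : MvPowerSeries (Fin m) ℂ := fun p =>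
  if p j = 0 then MvPowerSeries.coeff (p + Finsupp.single j k) P else 0

/-- The quotient by the `j`-th variable, after dropping the terms free of this variable. -/
def shift (j : Fin m) (P : MvPowerSeries (Fin m) ℂ) : MvPowerSeries (Fin m) ℂ := fun p =>
  MvPowerSeries.coeff (p + Finsupp.single j 1) P

theorem coeff_slice (j : Fin m) (k : ℕ) (P : MvPowerSeries (Fin m) ℂ) (p : Fin m →₀ ℕ) :
    MvPowerSeries.coeff p (slice j k P) =
      if p j = 0 then MvPowerSeries.coeff (p + Finsupp.single j k) P else 0 := rfl

theorem coeff_shift (j : Fin m) (P : MvPowerSeries (Fin m) ℂ) (p : Fin m →₀ ℕ) :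
    MvPowerSeries.coeff p (shift j P) = MvPowerSeries.coeff (p + Finsupp.single j 1) P := rfl

theorem eq_slice_add_shift_mul_X (j : Fin m) (P : MvPowerSeries (Fin m) ℂ) :
    P = slice j 0 P + shift j P * MvPowerSeries.X j := by
  classical
  ext p
  rw [map_add, coeff_slice, MvPowerSeries.X, MvPowerSeries.coeff_mul_monomial]
  by_cases hp : p j = 0
  · have : ¬ Finsupp.single j 1 ≤ p := fun h => by
      have := h j
      simp [hp] at this
    simp [hp, this]
  · have h1 : Finsupp.single j 1 ≤ p := Finsupp.single_le_iff.2 (Nat.one_le_iff_ne_zero.2 hp)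
    rw [if_neg hp, if_pos h1, zero_add, mul_one, coeff_shift, tsub_add_cancel_of_le h1]

theorem slice_shift (j : Fin m) (k : ℕ) (P : MvPowerSeries (Fin m) ℂ) :
    slice j k (shift j P) = slice j (k + 1) P := by
  ext p
  rw [coeff_slice, coeff_slice, coeff_shift, add_assoc, ← Finsupp.single_add]

theorem slice_pderiv (j : Fin m) (k : ℕ) (P : MvPowerSeries (Fin m) ℂ) :
    slice j k (MvPowerSeries.pderiv ℂ j P) = ((k : ℂ) + 1) • slice j (k + 1) P := by
  ext p
  rw [MvPowerSeries.coeff_smul, coeff_slice, coeff_slice, MvPowerSeries.coeff_pderiv, add_assoc,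
    ← Finsupp.single_add]
  by_cases hp : p j = 0
  · simp [hp, mul_comm]
  · simp [hp]

theorem slice_iterate_pderiv (j : Fin m) (k : ℕ) (P : MvPowerSeries (Fin m) ℂ) :
    ∀ r, ∃ c : ℂ, c ≠ 0 ∧ slice j r ((MvPowerSeries.pderiv ℂ j)^[k] P) = c • slice j (r + k) P := by
  induction k with
  | zero => exact fun r => ⟨1, one_ne_zero, by simp⟩
  | succ k ih =>
    intro r
    obtain ⟨c, hc, h⟩ := ih (r + 1)
    refine ⟨((r : ℂ) + 1) * c, mul_ne_zero (Nat.cast_add_one_ne_zero r) hc, ?_⟩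
    rw [Function.iterate_succ_apply', slice_pderiv, h, smul_smul, add_right_comm, add_assoc]

theorem evalSeries_eq_slice_add_shift (j : Fin m) (P : MvPowerSeries (Fin m) ℂ) :
    evalSeries Φ hΦ P = evalSeries Φ hΦ (slice j 0 P) + evalSeries Φ hΦ (shift j P) * Φ j := by
  conv_lhs => rw [eq_slice_add_shift_mul_X j P]
  rw [evalSeries_add, evalSeries_mul_X]

theorem evalSeries_mem_ordGE_of_slice (j : Fin m) {v : ℝ} (P : MvPowerSeries (Fin m) ℂ)
    (h : ∀ k, evalSeries Φ hΦ (slice j k P) ∈ ordGE v) : evalSeries Φ hΦ P ∈ ordGE v := by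
  obtain ⟨ε, hε, hj⟩ := exists_mem_ordGE Φ hΦ
  have key : ∀ (K : ℕ) (P : MvPowerSeries (Fin m) ℂ),
      (∀ k, evalSeries Φ hΦ (slice j k P) ∈ ordGE v) →
      evalSeries Φ hΦ P ∈ ordGE (min v (K * ε)) := by
    intro K
    induction K with
    | zero =>
      intro P _
      exact ordGE_anti (by simp) (evalSeries_mem_ordGE_zero hΦ P)
    | succ K ih =>
      intro P h
      rw [evalSeries_eq_slice_add_shift hΦ j]
      refine add_mem (ordGE_anti (min_le_left _ _) (h 0)) (ordGE_anti ?_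
        (mul_mem_ordGE (ih (shift j P) fun k => by rw [slice_shift]; exact h _) (hj j)))
      rw [← min_add_add_right]
      push_cast
      exact min_le_min (by linarith) (by linarith)
  obtain ⟨K, hK⟩ := exists_nat_gt (v / ε)
  have := key K P h
  rwa [min_eq_left ((div_lt_iff₀ hε).1 hK).le] at this

/-- Up to a nonzero factor, the `k`-th derivative has the `k`-th slice as its part free of the
`j`-th variable. The rest is a multiple of that variable and so has order larger by at least `ε`. It
cannot cancel a slice whose order is nearly the least among all slices. -/
theorem exists_iterate_pderiv_ne_zero (j : Fin m) (P : MvPowerSeries (Fin m) ℂ)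
    (h : ∃ k, evalSeries Φ hΦ (slice j k P) ≠ 0) :
    ∃ k, evalSeries Φ hΦ ((MvPowerSeries.pderiv ℂ j)^[k] P) ≠ 0 := by
  obtain ⟨ε, hε, hj⟩ := exists_mem_ordGE Φ hΦ
  set A : Set ℝ := {a | ∃ k, (evalSeries Φ hΦ (slice j k P)).coeff a ≠ 0} with hA
  have hne : A.Nonempty := by
    obtain ⟨k, hk⟩ := h
    by_contra hemp
    refine hk (HahnSeries.ext (funext fun a => ?_))
    by_contra ha
    exact hemp ⟨a, k, ha⟩
  have hbdd : BddBelow A := ⟨0, fun a ⟨k, hk⟩ => by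
    by_contra! hlt
    exact hk (evalSeries_mem_ordGE_zero hΦ _ a hlt)⟩
  have hv : ∀ k, evalSeries Φ hΦ (slice j k P) ∈ ordGE (sInf A) := fun k a ha => by
    by_contra hk
    exact absurd (csInf_le hbdd ⟨k, hk⟩) (not_le.2 ha)
  -- Being within `ε` of the infimum is enough; attainment is not needed.
  obtain ⟨a, ⟨k, hk⟩, hav⟩ := exists_lt_of_csInf_lt hne (lt_add_of_pos_right (sInf A) hε)
  refine ⟨k, fun h0 => ?_⟩
  have hQ : ∀ r, evalSeries Φ hΦ (slice j r (shift j ((MvPowerSeries.pderiv ℂ j)^[k] P)))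
      ∈ ordGE (sInf A) := fun r => by
    obtain ⟨c, -, hc⟩ := slice_iterate_pderiv j k P (r + 1)
    rw [slice_shift, hc, evalSeries_smul]
    exact C_mul_mem_ordGE c (hv _)
  have h1 := mul_mem_ordGE (evalSeries_mem_ordGE_of_slice hΦ j _ hQ) (hj j) a hav
  obtain ⟨c, hc0, hc⟩ := slice_iterate_pderiv j k P 0
  rw [evalSeries_eq_slice_add_shift hΦ j, hc, evalSeries_smul, zero_add] at h0
  have h2 := congrArg (fun x => HahnSeries.coeff x a) h0
  simp only [HahnSeries.coeff_add, h1, add_zero, coeff_C_mul_apply, HahnSeries.coeff_zero] at h2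
  exact mul_ne_zero hc0 hk h2

/-- The power series `P(x, y₀, …, yₙ)` does not involve the variables `y_i` with `i < k`. -/
def IsFreeBelow {n : ℕ} (k : ℕ) (P : MvPowerSeries (Fin (n + 2)) ℂ) : Prop :=
  ∀ p, MvPowerSeries.coeff p P ≠ 0 → ∀ i : Fin (n + 1), (i : ℕ) < k → p i.succ = 0

theorem IsFreeBelow.pderiv {n k : ℕ} {P : MvPowerSeries (Fin (n + 2)) ℂ} (h : IsFreeBelow k P)
    (j : Fin (n + 2)) : IsFreeBelow k (MvPowerSeries.pderiv ℂ j P) := fun p hp i hi => by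
  rw [MvPowerSeries.coeff_pderiv] at hp
  have := h _ (left_ne_zero_of_mul hp) i hi
  rw [Finsupp.add_apply] at this
  omega

theorem IsFreeBelow.iterate_pderiv {n k : ℕ} {P : MvPowerSeries (Fin (n + 2)) ℂ}
    (h : IsFreeBelow k P) (j : Fin (n + 2)) (r : ℕ) :
    IsFreeBelow k ((MvPowerSeries.pderiv ℂ j)^[r] P) := by
  induction r with
  | zero => exact h
  | succ r ih => rw [Function.iterate_succ_apply']; exact ih.pderiv j

theorem IsFreeBelow.pderiv_eq_zero {n k : ℕ} {P : MvPowerSeries (Fin (n + 2)) ℂ}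
    (h : IsFreeBelow k P) {j : Fin (n + 1)} (hj : (j : ℕ) < k) :
    MvPowerSeries.pderiv ℂ j.succ P = 0 := by
  ext p
  rw [MvPowerSeries.coeff_pderiv, map_zero]
  by_contra hne
  have := h _ (left_ne_zero_of_mul hne) j hj
  simp at this

theorem evalSeries_ne_zero_of_isFreeBelow {n : ℕ} {Φ : Fin (n + 2) → HahnSeries ℝ ℂ}
    (hΦ : ∀ i, (Φ i).support ⊆ Set.Ioi 0) (h0 : Φ 0 = HahnSeries.single (1 : ℝ) (1 : ℂ))
    {P : MvPowerSeries (Fin (n + 2)) ℂ} (hP : P ≠ 0) (hfree : IsFreeBelow (n + 1) P) :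
    evalSeries Φ hΦ P ≠ 0 := by
  obtain ⟨p, hp⟩ : ∃ p, MvPowerSeries.coeff p P ≠ 0 := by
    by_contra! h
    exact hP (MvPowerSeries.ext h)
  have hprod : ∀ q, MvPowerSeries.coeff q P ≠ 0 →
      ∏ i, Φ i ^ q i = HahnSeries.single (q 0 : ℝ) (1 : ℂ) := fun q hq => by
    rw [Fin.prod_univ_succ, Finset.prod_eq_one fun i _ => by rw [hfree q hq i i.2, pow_zero],
      mul_one, h0, HahnSeries.single_pow]
    simp
  intro hz
  have hc : substCoeff P Φ (p 0 : ℝ) = 0 := congrArg (fun x => HahnSeries.coeff x (p 0 : ℝ)) hz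
  unfold substCoeff at hc
  rw [finsum_eq_single _ p, hprod p hp, HahnSeries.coeff_single_same, mul_one] at hc
  · exact hp hc
  · intro q hqp
    by_cases hq : MvPowerSeries.coeff q P = 0
    · rw [hq, zero_mul]
    · rw [hprod q hq, HahnSeries.coeff_single_of_ne, mul_zero]
      intro he
      apply hqp
      ext i
      refine Fin.cases ?_ (fun i => ?_) i
      · exact_mod_cast he.symm
      · rw [hfree q hq i i.2, hfree p hp i i.2]

/-- A relation between `x` and `Φ₁, …, Φₙ₊₁` yields one that is regular with respect to the first
variable it involves. -/
theorem exists_regular_relation {n : ℕ} {Φ : Fin (n + 2) → HahnSeries ℝ ℂ}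
    (hΦ : ∀ i, (Φ i).support ⊆ Set.Ioi 0) (h0 : Φ 0 = HahnSeries.single (1 : ℝ) (1 : ℂ))
    {P : MvPowerSeries (Fin (n + 2)) ℂ} (hP : P ≠ 0) (hz : evalSeries Φ hΦ P = 0) :
    ∃ (j : Fin (n + 1)) (G : MvPowerSeries (Fin (n + 2)) ℂ), IsFreeBelow j G ∧
      evalSeries Φ hΦ G = 0 ∧ evalSeries Φ hΦ (MvPowerSeries.pderiv ℂ j.succ G) ≠ 0 := by
  have main : ∀ (d k : ℕ), k + d = n + 1 → ∀ P : MvPowerSeries (Fin (n + 2)) ℂ, P ≠ 0 →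
      IsFreeBelow k P → evalSeries Φ hΦ P = 0 →
      ∃ (j : Fin (n + 1)) (G : MvPowerSeries (Fin (n + 2)) ℂ), IsFreeBelow j G ∧
        evalSeries Φ hΦ G = 0 ∧ evalSeries Φ hΦ (MvPowerSeries.pderiv ℂ j.succ G) ≠ 0 := by
    intro d
    induction d with
    | zero =>
      intro k hk P hP hfree hz
      obtain rfl : k = n + 1 := by omega
      exact absurd hz (evalSeries_ne_zero_of_isFreeBelow hΦ h0 hP hfree)
    | succ d ih =>
      intro k hk P hP hfree hz
      set j : Fin (n + 1) := ⟨k, by omega⟩ with hj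
      by_cases hs : ∃ r, evalSeries Φ hΦ (slice j.succ r P) ≠ 0
      · classical
        -- The least order of a derivative nonvanishing along `Φ` is positive since `P` itself
        -- vanishes there; the derivative one order lower is the required `G`.
        have hex := exists_iterate_pderiv_ne_zero hΦ j.succ P hs
        obtain ⟨r, hr⟩ : ∃ r, Nat.find hex = r + 1 := by
          refine Nat.exists_eq_succ_of_ne_zero fun h => ?_
          have := Nat.find_spec hex
          rw [h] at this
          exact this hz
        refine ⟨j, (MvPowerSeries.pderiv ℂ j.succ)^[r] P, hfree.iterate_pderiv _ r, ?_, ?_⟩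
        · by_contra hne
          have := Nat.find_min' hex hne
          omega
        · have := Nat.find_spec hex
          rwa [hr, Function.iterate_succ_apply'] at this
      -- If every slice vanishes along `Φ`, any nonzero slice is again a relation, and it involves
      -- one variable fewer.
      · push Not at hs
        obtain ⟨p, hp⟩ : ∃ p, MvPowerSeries.coeff p P ≠ 0 := by
          by_contra! h
          exact hP (MvPowerSeries.ext h)
        refine ih (k + 1) (by omega) (slice j.succ (p j.succ) P) (fun h => ?_) (fun q hq i hi => ?_)
          (hs _)
        · have h1 : MvPowerSeries.coeff (p.erase j.succ) (slice j.succ (p j.succ) P) = 0 := by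
            rw [h]; rfl
          rw [coeff_slice, if_pos Finsupp.erase_same, Finsupp.erase_add_single] at h1
          exact hp h1
        · rw [coeff_slice] at hq
          by_cases hqj : q j.succ = 0
          · rw [if_pos hqj] at hq
            rcases (Nat.lt_succ_iff_lt_or_eq.1 hi) with hi | hi
            · have := hfree _ hq i hi
              rw [Finsupp.add_apply] at this
              omega
            · have : i = j := Fin.ext hi
              rw [this]; exact hqj
          · rw [if_neg hqj] at hq
            exact absurd rfl hq
  exact main (n + 1) 0 (by omega) P hP (fun p _ i hi => absurd hi (Nat.not_lt_zero _)) hz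

end Selection

/-! ### The recursion satisfied by the exponents of `φ`. -/

theorem coeff_mul_add {s t : ℝ} {x y : HahnSeries ℝ ℂ} (hx : x ∈ ordGE s) (hy : y ∈ ordGE t) :
    (x * y).coeff (s + t) = x.coeff s * y.coeff t := by
  rw [HahnSeries.coeff_mul]
  refine Finset.sum_eq_single (s, t) (fun p hp hne => ?_) fun hnot => ?_
  · obtain ⟨h1, h2, h3⟩ := Finset.mem_antidiagonal.1 hp
    have h4 : s ≤ p.1 := mem_ordGE_iff_support.1 hx h1
    have h5 : t ≤ p.2 := mem_ordGE_iff_support.1 hy h2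
    exact absurd (Prod.ext (by linarith) (by linarith)) hne
  · by_contra hne
    exact hnot (Finset.mem_antidiagonal.2
      ⟨left_ne_zero_of_mul hne, right_ne_zero_of_mul hne, rfl⟩)

theorem exists_min_exponent {ι : Type*} [Finite ι] (H : ι → HahnSeries ℝ ℂ)
    (h0 : ∀ i, H i ∈ ordGE 0) (hne : ∃ i, H i ≠ 0) :
    ∃ ν : ℝ, 0 ≤ ν ∧ (∀ i, H i ∈ ordGE ν) ∧ ∃ i, (H i).coeff ν ≠ 0 := by
  have : Nonempty ι := hne.nonempty
  obtain ⟨i, hi, hmin⟩ : ∃ i, H i ≠ 0 ∧ ∀ k, H k ≠ 0 → (H i).order ≤ (H k).order := by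
    obtain ⟨i, hi, h⟩ := Set.exists_min_image {i | H i ≠ 0} (fun i => (H i).order)
      (Set.toFinite _) hne
    exact ⟨i, hi, h⟩
  refine ⟨(H i).order, ?_, fun k a ha => ?_, i, HahnSeries.coeff_order_eq_zero.not.2 hi⟩
  · exact mem_ordGE_iff_support.1 (h0 i) (HahnSeries.coeff_order_eq_zero.not.2 hi)
  · by_contra hk
    have hk0 : H k ≠ 0 := fun h => hk (by rw [h]; rfl)
    exact absurd ((hmin k hk0).trans (HahnSeries.order_le_of_coeff_ne_zero hk)) (not_le.2 ha)

theorem IsGeneralizedPowerSeries.finite_support_inter_Iic {φ : HahnSeries ℝ ℂ}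
    (h : IsGeneralizedPowerSeries φ) (N : ℝ) : (φ.support ∩ Set.Iic N).Finite := by
  obtain ⟨c, lam, -, hm, ht, hc⟩ := h
  obtain ⟨K, hK⟩ := (ht.eventually_gt_atTop N).exists
  refine ((Finset.range K).finite_toSet.image lam).subset fun a ⟨ha, haN⟩ => ?_
  have : ∃ k, lam k = a := by
    by_contra! hne
    exact ha (by rw [hc a]; simp [hne])
  obtain ⟨k, rfl⟩ := this
  refine ⟨k, ?_, rfl⟩
  rw [Finset.coe_range, Set.mem_Iio]
  by_contra! hle
  exact absurd (Set.mem_Iic.1 haN) (not_le.2 (hK.trans_le (hm hle)))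

/-- The multiplier of the `i`-th iterate of the operator `x^a ↦ w(l a) x^(l a)`. -/
def multiplier (w : ℝ → ℂ) (l : ℕ) (i : ℕ) (a : ℝ) : ℂ := ∏ k ∈ Finset.range i, w (a / l ^ k)

theorem coeff_iterate {w : ℝ → ℂ} {l : ℕ} {D : HahnSeries ℝ ℂ → HahnSeries ℝ ℂ}
    (hD : ∀ ψ a, (D ψ).coeff a = w a * ψ.coeff (a / l)) (ψ : HahnSeries ℝ ℂ) (i : ℕ) (a : ℝ) :
    (D^[i] ψ).coeff a = multiplier w l i a * ψ.coeff (a / l ^ i) := by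
  induction i generalizing ψ with
  | zero => simp [multiplier]
  | succ i ih =>
    rw [Function.iterate_succ_apply, ih, hD, multiplier, multiplier, Finset.prod_range_succ,
      div_div, ← pow_succ, mul_assoc]

/-- The tuple `(x, φ, D φ, …, Dⁿ φ)` with the entries `Dⁱ φ`, `i < k`, replaced by zero. -/
def tailJet (n k : ℕ) (D : HahnSeries ℝ ℂ → HahnSeries ℝ ℂ) (φ : HahnSeries ℝ ℂ) :
    Fin (n + 2) → HahnSeries ℝ ℂ :=
  Fin.cons (HahnSeries.single (1 : ℝ) (1 : ℂ)) fun i : Fin (n + 1) =>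
    if (i : ℕ) < k then 0 else D^[(i : ℕ)] φ

theorem tailJet_zero (n k : ℕ) (D : HahnSeries ℝ ℂ → HahnSeries ℝ ℂ) (φ : HahnSeries ℝ ℂ) :
    tailJet n k D φ 0 = HahnSeries.single (1 : ℝ) (1 : ℂ) := rfl

theorem tailJet_succ (n k : ℕ) (D : HahnSeries ℝ ℂ → HahnSeries ℝ ℂ) (φ : HahnSeries ℝ ℂ)
    (i : Fin (n + 1)) :
    tailJet n k D φ i.succ = if (i : ℕ) < k then 0 else D^[(i : ℕ)] φ := rfl

theorem tailJet_support_pos (n k : ℕ) {D : HahnSeries ℝ ℂ → HahnSeries ℝ ℂ}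
    (hD : ∀ ψ : HahnSeries ℝ ℂ, ψ.support ⊆ Set.Ioi 0 → (D ψ).support ⊆ Set.Ioi 0)
    {φ : HahnSeries ℝ ℂ} (hφ : φ.support ⊆ Set.Ioi 0) (i : Fin (n + 2)) :
    (tailJet n k D φ i).support ⊆ Set.Ioi 0 := by
  refine Fin.cases (jet_support_pos n D hD hφ 0) (fun i => ?_) i
  rw [tailJet_succ]
  split_ifs
  · simp
  · exact jet_support_pos n D hD hφ i.succ

theorem evalSeries_tailJet {n k : ℕ} {D : HahnSeries ℝ ℂ → HahnSeries ℝ ℂ}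
    {φ : HahnSeries ℝ ℂ} (h : ∀ i, (jet n D φ i).support ⊆ Set.Ioi 0)
    (h' : ∀ i, (tailJet n k D φ i).support ⊆ Set.Ioi 0)
    {G : MvPowerSeries (Fin (n + 2)) ℂ} (hG : IsFreeBelow k G) :
    evalSeries (tailJet n k D φ) h' G = evalSeries (jet n D φ) h G := by
  refine evalSeries_congr h' h fun p hp i => ?_
  refine Fin.cases (fun _ => rfl) (fun i hi => ?_) i
  rw [tailJet_succ, if_neg fun hik => hi (hG p hp i hik)]
  rfl

section Core

variable {n : ℕ} {w : ℝ → ℂ} {l : ℕ} {D : HahnSeries ℝ ℂ → HahnSeries ℝ ℂ}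

theorem support_pos_of_coeff (hl : 1 ≤ l) (hD : ∀ ψ a, (D ψ).coeff a = w a * ψ.coeff (a / l))
    (ψ : HahnSeries ℝ ℂ) (hψ : ψ.support ⊆ Set.Ioi 0) : (D ψ).support ⊆ Set.Ioi 0 := by
  intro a ha
  have hl0 : (0 : ℝ) < l := by exact_mod_cast hl
  have h1 : (D ψ).coeff a ≠ 0 := ha
  rw [hD] at h1
  have : 0 < a / l := hψ (right_ne_zero_of_mul h1)
  exact (div_pos_iff_of_pos_right hl0).1 this

theorem iterate_truncLT_sub_mem_ordGE (hl : 1 ≤ l)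
    (hD : ∀ ψ a, (D ψ).coeff a = w a * ψ.coeff (a / l)) (φ : HahnSeries ℝ ℂ) (c : ℝ) (i : ℕ) :
    D^[i] (HahnSeries.truncLT c φ) - D^[i] φ ∈ ordGE (l ^ i * c) := by
  intro a ha
  have hl0 : (0 : ℝ) < (l : ℝ) ^ i := pow_pos (by exact_mod_cast hl) i
  have h1 : a / l ^ i < c := by rwa [div_lt_iff₀ hl0, mul_comm]
  rw [HahnSeries.coeff_sub, coeff_iterate hD, coeff_iterate hD, HahnSeries.coeff_truncLT_of_lt h1,
    sub_self]

theorem coeff_iterate_truncLT_sub (hl : 1 ≤ l)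
    (hD : ∀ ψ a, (D ψ).coeff a = w a * ψ.coeff (a / l)) (φ : HahnSeries ℝ ℂ) (c : ℝ) (i : ℕ) :
    (D^[i] (HahnSeries.truncLT c φ) - D^[i] φ).coeff (l ^ i * c) =
      -(multiplier w l i (l ^ i * c) * φ.coeff c) := by
  have hl0 : (l : ℝ) ^ i ≠ 0 := (pow_pos (by exact_mod_cast hl) i).ne'
  rw [HahnSeries.coeff_sub, coeff_iterate hD, coeff_iterate hD, mul_div_cancel_left₀ _ hl0,
    HahnSeries.coeff_truncLT_of_le le_rfl, mul_zero, zero_sub]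

/-- The coefficient of a relation at the truncation of `φ` below `c`, at the exponent where the
term `φ_c x^c` first contributes. -/
theorem coeff_evalSeries_truncLT (hl : 1 ≤ l) (hD : ∀ ψ a, (D ψ).coeff a = w a * ψ.coeff (a / l))
    {φ : HahnSeries ℝ ℂ} {k : ℕ} {G : MvPowerSeries (Fin (n + 2)) ℂ} (hG : IsFreeBelow k G)
    (h : ∀ i, (tailJet n k D φ i).support ⊆ Set.Ioi 0)
    (hz : evalSeries (tailJet n k D φ) h G = 0) {ν c : ℝ} (hν : 0 ≤ ν) (hc : ν < l ^ k * c)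
    (h' : ∀ i, (tailJet n k D (HahnSeries.truncLT c φ) i).support ⊆ Set.Ioi 0)
    (hord : ∀ i : Fin (n + 1), l ^ (i : ℕ) = l ^ k →
      evalSeries (tailJet n k D φ) h (MvPowerSeries.pderiv ℂ i.succ G) ∈ ordGE ν) :
    (evalSeries (tailJet n k D (HahnSeries.truncLT c φ)) h' G).coeff (ν + l ^ k * c) =
      -((∑ i : Fin (n + 1), if l ^ (i : ℕ) = l ^ k then
        (evalSeries (tailJet n k D φ) h (MvPowerSeries.pderiv ℂ i.succ G)).coeff ν *
          multiplier w l i (l ^ k * c) else 0) * φ.coeff c) := by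
  have hl0 : (0 : ℝ) < (l : ℝ) ^ k := pow_pos (by exact_mod_cast hl) k
  have hl1 : (1 : ℝ) ≤ l := by exact_mod_cast hl
  have hc0 : 0 < c := by
    by_contra! hneg
    nlinarith
  have hΨ : ∀ i : Fin (n + 1), ¬ (i : ℕ) < k →
      tailJet n k D (HahnSeries.truncLT c φ) i.succ - tailJet n k D φ i.succ =
        D^[(i : ℕ)] (HahnSeries.truncLT c φ) - D^[(i : ℕ)] φ := fun i hi => by
    rw [tailJet_succ, tailJet_succ, if_neg hi, if_neg hi]
  have hΨ0 : ∀ i : Fin (n + 1), (i : ℕ) < k →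
      tailJet n k D (HahnSeries.truncLT c φ) i.succ - tailJet n k D φ i.succ = 0 := fun i hi => by
    rw [tailJet_succ, tailJet_succ, if_pos hi, if_pos hi, sub_self]
  have hmem : ∀ i, tailJet n k D (HahnSeries.truncLT c φ) i - tailJet n k D φ i
      ∈ ordGE (l ^ k * c) := by
    refine Fin.cases ?_ fun i => ?_
    · rw [tailJet_zero, tailJet_zero, sub_self]; exact zero_mem _
    · by_cases hi : (i : ℕ) < k
      · rw [hΨ0 i hi]; exact zero_mem _
      · rw [hΨ i hi]
        exact ordGE_anti (mul_le_mul_of_nonneg_right (pow_le_pow_right₀ hl1 (not_lt.1 hi)) hc0.le)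
          (iterate_truncLT_sub_mem_ordGE hl hD φ c i)
  -- The exponent `ν + l ^ k * c` lies below `2 * (l ^ k * c)` by `hc`, so the quadratic error does
  -- not reach it.
  have ht := evalSeries_taylor h h' (mul_pos hl0 hc0).le hmem G (ν + l ^ k * c) (by linarith)
  rw [hz, sub_zero, HahnSeries.coeff_sub, sub_eq_zero, Fin.sum_univ_succ, tailJet_zero,
    tailJet_zero, sub_self, mul_zero, zero_add, HahnSeries.coeff_sum] at ht
  rw [ht, Finset.sum_mul, ← Finset.sum_neg_distrib]
  refine Finset.sum_congr rfl fun i _ => ?_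
  by_cases hi : (i : ℕ) < k
  · rw [hΨ0 i hi, mul_zero, hG.pderiv_eq_zero hi, evalSeries_zero]
    simp
  · rw [hΨ i hi]
    split_ifs with hik
    · have e : (l : ℝ) ^ k * c = l ^ (i : ℕ) * c := by
        have : (l : ℝ) ^ (i : ℕ) = l ^ k := by exact_mod_cast hik
        rw [this]
      rw [e, coeff_mul_add (hord i hik) (iterate_truncLT_sub_mem_ordGE hl hD φ c i),
        coeff_iterate_truncLT_sub hl hD]
      ring
    · have h2 : 2 ≤ l := by
        by_contra! hlt
        obtain rfl : l = 1 := by omega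
        simp at hik
      have hlt : k + 1 ≤ (i : ℕ) := by
        rcases (not_lt.1 hi).eq_or_lt with he | hlt
        · exact absurd (by rw [← he]) hik
        · exact hlt
      -- For `l ≥ 2` the increments of `D^i φ` with `i > k` start at `2 * (l ^ k * c)` or later,
      -- again beyond the exponent considered.
      have h3 : 2 * ((l : ℝ) ^ k * c) ≤ 0 + l ^ (i : ℕ) * c := by
        have h4 : (l : ℝ) ^ (k + 1) ≤ l ^ (i : ℕ) := pow_le_pow_right₀ hl1 hlt
        have h5 : 2 * (l : ℝ) ^ k ≤ l ^ (k + 1) := by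
          rw [pow_succ, mul_comm]
          exact mul_le_mul_of_nonneg_left (by exact_mod_cast h2) hl0.le
        have := mul_le_mul_of_nonneg_right (h5.trans h4) hc0.le
        linarith
      rw [mul_mem_ordGE (evalSeries_mem_ordGE_zero h _)
        (iterate_truncLT_sub_mem_ordGE hl hD φ c i) _ (lt_of_lt_of_le (by linarith) h3)]
      simp

/-- Entries with `i < k` have been zeroed, so every surviving exponent `l ^ i * b` stays a natural
multiple of `b` after division by `l ^ k`. -/
theorem div_mem_closure_of_mem_closure_tailJet (hl : 1 ≤ l)
    (hD : ∀ ψ a, (D ψ).coeff a = w a * ψ.coeff (a / l)) (φ : HahnSeries ℝ ℂ) (k : ℕ) (c : ℝ)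
    {x : ℝ} (hx : x ∈ AddSubmonoid.closure
      (⋃ i, (tailJet n k D (HahnSeries.truncLT c φ) i).support)) :
    x / l ^ k ∈ AddSubmonoid.closure (insert (1 / (l : ℝ) ^ k) (φ.support ∩ Set.Iio c)) := by
  have hl0 : (l : ℝ) ≠ 0 := by
    have : (0 : ℝ) < l := by exact_mod_cast hl
    exact this.ne'
  induction hx using AddSubmonoid.closure_induction with
  | zero => simp
  | add x y _ _ hx hy => rw [add_div]; exact add_mem hx hy
  | mem x hx =>
    obtain ⟨i, hi⟩ := Set.mem_iUnion.1 hx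
    revert hi
    refine Fin.cases (fun hi => ?_) (fun i hi => ?_) i
    · have : x = 1 := HahnSeries.support_single_subset hi
      rw [this]
      exact AddSubmonoid.mem_closure_of_mem (Set.mem_insert _ _)
    · rw [tailJet_succ] at hi
      split_ifs at hi with hik
      · simp at hi
      · have h1 : (D^[(i : ℕ)] (HahnSeries.truncLT c φ)).coeff x ≠ 0 := hi
        rw [coeff_iterate hD] at h1
        have h2 : x / l ^ (i : ℕ) ∈ (HahnSeries.truncLT c φ).support := right_ne_zero_of_mul h1
        rw [HahnSeries.support_truncLT] at h2
        have h3 : x / l ^ k = (l ^ ((i : ℕ) - k)) • (x / (l : ℝ) ^ (i : ℕ)) := by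
          rw [nsmul_eq_mul]
          push_cast
          rw [← Nat.sub_add_cancel (not_lt.1 hik), Nat.add_sub_cancel, pow_add]
          field_simp
        rw [h3]
        refine AddSubmonoid.nsmul_mem _ (AddSubmonoid.mem_closure_of_mem
          (Set.mem_insert_of_mem _ ?_)) _
        exact ⟨h2.1, h2.2⟩

/-- For `l = 1` the sum is a nonzero polynomial evaluated at `w c`, so the exceptional `c` lie in
finitely many fibers of `w`. For `l ≥ 2` a single term survives, with multiplier `1`, and there is
no exceptional `c`. -/
theorem exists_exceptional_generators (hw : (l = 1 ∧ HasFGFibers w) ∨ (2 ≤ l ∧ ∀ a, w a = 1))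
    (k : ℕ) (b : Fin (n + 1) → ℂ) (hb : ∃ i : Fin (n + 1), l ^ (i : ℕ) = l ^ k ∧ b i ≠ 0) (t : ℝ) :
    ∃ E : Finset ℝ, (∀ x ∈ E, 0 < x) ∧ ∀ c : ℝ, t < c →
      (∑ i : Fin (n + 1), if l ^ (i : ℕ) = l ^ k then b i * multiplier w l i (l ^ k * c) else 0) = 0 →
      c - t ∈ AddSubmonoid.closure (E : Set ℝ) := by
  obtain ⟨i₀, hi₀, hbi⟩ := hb
  rcases hw with ⟨rfl, hw⟩ | ⟨hl, hw⟩
  · set p : Polynomial ℂ := ∑ i : Fin (n + 1), Polynomial.monomial (i : ℕ) (b i) with hp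
    have hp0 : p ≠ 0 := fun h => by
      have h1 := congrArg (fun q => Polynomial.coeff q (i₀ : ℕ)) h
      simp only [hp, Polynomial.finsetSum_coeff, Polynomial.coeff_monomial, Polynomial.coeff_zero,
        Fin.val_inj] at h1
      simp at h1
      exact hbi h1
    obtain ⟨E, hE, h⟩ := hw.exists_generators_of_isRoot hp0 t
    refine ⟨E, hE, fun c hc hs => h c ?_ hc⟩
    rw [← hs, hp, Polynomial.eval_finsetSum]
    refine Finset.sum_congr rfl fun i _ => ?_
    simp [multiplier]
  · refine ⟨∅, by simp, fun c hc hs => ?_⟩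
    have hinj : ∀ i : Fin (n + 1), l ^ (i : ℕ) = l ^ k ↔ i = i₀ := fun i => by
      rw [← hi₀]
      refine ⟨fun h => Fin.ext (Nat.pow_right_injective hl h), fun h => by rw [h]⟩
    simp [hinj, multiplier, hw] at hs
    exact absurd hs hbi

theorem exists_generators_of_relation (hl : 1 ≤ l)
    (hD : ∀ ψ a, (D ψ).coeff a = w a * ψ.coeff (a / l))
    (hw : (l = 1 ∧ HasFGFibers w) ∨ (2 ≤ l ∧ ∀ a, w a = 1))
    {φ : HahnSeries ℝ ℂ} (hφ : IsGeneralizedPowerSeries φ)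
    {P : MvPowerSeries (Fin (n + 2)) ℂ} (hP : P ≠ 0)
    (hsol : ∀ a : ℝ, substCoeff P (jet n D φ) a = 0) :
    ∃ T : Finset ℝ, (∀ x ∈ T, 0 < x) ∧ φ.support ⊆ AddSubmonoid.closure (T : Set ℝ) := by
  have hDpos := support_pos_of_coeff hl hD
  have hΦ := jet_support_pos n D hDpos hφ.support_pos
  obtain ⟨j, G, hG, hGz, hGj⟩ := exists_regular_relation hΦ rfl hP
    (HahnSeries.ext (funext hsol) : evalSeries (jet n D φ) hΦ P = 0)
  have h := tailJet_support_pos n j hDpos hφ.support_pos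
  rw [← evalSeries_tailJet hΦ h hG] at hGz
  rw [← evalSeries_tailJet hΦ h (hG.pderiv _)] at hGj
  set H : Fin (n + 1) → HahnSeries ℝ ℂ := fun i =>
    evalSeries (tailJet n j D φ) h (MvPowerSeries.pderiv ℂ i.succ G) with hH
  -- The condition `l ^ i = l ^ j` treats both cases at once: it holds for all `i` if `l = 1` and
  -- only for `i = j` if `l ≥ 2`.
  obtain ⟨ν, hν, hord, ⟨i₀, hi₀⟩, hne⟩ := exists_min_exponent
    (fun i : {i : Fin (n + 1) // l ^ (i : ℕ) = l ^ (j : ℕ)} => H i)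
    (fun i => evalSeries_mem_ordGE_zero h _) ⟨⟨j, rfl⟩, hGj⟩
  have hl0 : (0 : ℝ) < (l : ℝ) ^ (j : ℕ) := pow_pos (by exact_mod_cast hl) _
  obtain ⟨E, hE, hexc⟩ := exists_exceptional_generators hw j (fun i => (H i).coeff ν)
    ⟨i₀, hi₀, hne⟩ (ν / l ^ (j : ℕ))
  have hνl : 0 ≤ ν / (l : ℝ) ^ (j : ℕ) := div_nonneg hν hl0.le
  -- The shift is `ν / l ^ j`, the extra generator `1 / l ^ j` comes from `x`, and `le_rfl` fixes
  -- the threshold `N` as twice the shift.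
  refine exists_generators_of_recursion (fun x hx => hφ.support_pos hx)
    hφ.finite_support_inter_Iic (one_div_pos.2 hl0) hνl le_rfl E hE fun c hc hNc => ?_
  have hlt : ν / l ^ (j : ℕ) < c := by linarith
  by_cases hs : (∑ i : Fin (n + 1), if l ^ (i : ℕ) = l ^ (j : ℕ) then
      (H i).coeff ν * multiplier w l i (l ^ (j : ℕ) * c) else 0) = 0
  · exact Or.inl (hexc c hlt hs)
  · right
    have h' := tailJet_support_pos n j hDpos
      (φ := HahnSeries.truncLT c φ) ((HahnSeries.support_truncLT_subset c φ).trans hφ.support_pos)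
    have hcoef := coeff_evalSeries_truncLT hl hD hG h hGz hν
      (by rwa [div_lt_iff₀ hl0, mul_comm] at hlt) h' fun i hi => hord ⟨i, hi⟩
    have hne0 : substCoeff G (tailJet n j D (HahnSeries.truncLT c φ)) (ν + l ^ (j : ℕ) * c) ≠ 0 := by
      change (evalSeries _ h' G).coeff _ ≠ 0
      rw [hcoef]
      exact neg_ne_zero.2 (mul_ne_zero hs hc)
    have := div_mem_closure_of_mem_closure_tailJet hl hD φ j c (support_substCoeff_subset _ _ hne0)
    rwa [add_div, mul_div_cancel_left₀ _ hl0.ne', add_comm _ c] at this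

end Core

end GenSeries

end

theorem mainTheorem5 (n : ℕ) (F : (Fin (n + 2) → ℂ) → ℂ)
    (hF : AnalyticAt ℂ F 0) (hF0 : ¬ F =ᶠ[𝓝 0] 0)
    (φ : HahnSeries ℝ ℂ) (hφ : GenSeries.IsGeneralizedPowerSeries φ)
    (hsol :
      GenSeries.IsFormalSolution n F GenSeries.eulerOp φ ∨
      (∃ q L : ℂ, q ≠ 0 ∧ q ≠ 1 ∧ Complex.exp L = q ∧
        GenSeries.IsFormalSolution n F (GenSeries.qOp L) φ) ∨
      (∃ (l : ℕ) (hl : 2 ≤ l),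
        GenSeries.IsFormalSolution n F (GenSeries.mahlerOp l hl) φ)) :
    ∃ (τ : ℕ) (ρ : Fin τ → ℝ),
      (∀ i, 0 < ρ i) ∧ LinearIndependent ℤ ρ ∧
      φ ∈ GenSeries.seriesWithExponents (AddSubsemigroup.closure (Set.range ρ)) := by
  have hP := GenSeries.taylorSeries_ne_zero hF hF0
  obtain ⟨T, hT, hsupp⟩ : ∃ T : Finset ℝ, (∀ x ∈ T, 0 < x) ∧
      φ.support ⊆ AddSubmonoid.closure (T : Set ℝ) := by
    rcases hsol with hsol | ⟨q, L, -, hq, hL, hsol⟩ | ⟨l, hl, hsol⟩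
    · exact GenSeries.exists_generators_of_relation (w := fun a => (a : ℂ)) le_rfl
        (fun ψ a => by simp [GenSeries.eulerOp]) (Or.inl ⟨rfl, GenSeries.hasFGFibers_ofReal⟩)
        hφ hP hsol
    · have hL0 : L ≠ 0 := fun h => hq (by rw [← hL, h, Complex.exp_zero])
      exact GenSeries.exists_generators_of_relation (w := fun a => Complex.exp (a * L)) le_rfl
        (fun ψ a => by simp [GenSeries.qOp]) (Or.inl ⟨rfl, GenSeries.hasFGFibers_exp hL0⟩)
        hφ hP hsol
    · exact GenSeries.exists_generators_of_relation (w := fun _ => 1) (by omega : 1 ≤ l)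
        (fun ψ a => by simp [GenSeries.mahlerOp]) (Or.inr ⟨hl, fun _ => rfl⟩) hφ hP hsol
  obtain ⟨τ, ρ, hρ, hli, hTρ⟩ := GenSeries.exists_independent_generators T hT
  refine ⟨τ, ρ, hρ, hli, hφ, fun a ha => ?_⟩
  exact GenSeries.mem_addSubsemigroup_closure
    (AddSubmonoid.closure_le.2 hTρ (hsupp ha)) (hφ.support_pos ha).ne'
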